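/- **Setting.** Consider a POMDP with state space $X$, action space $A$, observation space $Z$, transition kernel $T(dx'\mid x,a)$, observation density $O(z\mid x)$ and state cost $c_x(x,a)$ with $|c_x|\le R_{\max}$. A particle belief is $\bar b=\{(x^j,w^j)\}_{j=1}^{N_x}$, $N_x\ge 1$, $w^j\ge 0$, with cost $c(\bar b,a)=\sum_j w^jc_x(x^j,a)/\sum_j w^j$ ($0$ if all weights vanish). The particle belief MDP $M_P$ has the following transition kernel $P(d\bar b'\mid\bar b,a)$: draw $x_0$ among the $x^j$ with probabilities $w^j/\sum_i w^i$ (uniformly if all weights vanish), $x_0'\sim T(\cdot\mid x_0,a)$, $z\sim O(\cdot\mid x_0')$; independently draw $x'^j\sim T(\cdot\mid x^j,a)$ for all $j$; put $w'^j=w^j\,O(z\mid x'^j)$, $\bar b'=\{(x'^j,w'^j)\}_j$. The simplified model $M_{P_s}$ has the same beliefs and costs and an arbitrary Markov transition kernel $P_s$ on particle beliefs. Fix times $k,T$ with $k+1<T$, a particle belief $\bar b_k$, an action $a_k$ and a (time-dependent, measurable) policy $\pi$, with $a_t=\pi_t(b_t)$ for $t>k$; put $R_{s:t}=\sum_{\tau=s}^t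 c(b_\tau,a_\tau)$ (so $R_{k+1:k}=0$). For a real random variable $Y$ and numbers $y_1,\dots,y_n$ let $$\mathrm{CVaR}_\alpha(Y)=\inf_{w}\{w+\tfrac1\alpha\mathbb E[(Y-w)^+]\},\qquad \hat C_\alpha(y_1,\dots,y_n)=\inf_w\{w+\tfrac1{n\alpha}\sum_{i}(y_i-w)^+\},$$ and let $Q^\pi_{M_P}(\bar b_k,a_k,\alpha)$ be the $\mathrm{CVaR}_\alpha$ of $R_{k:T}$ under $P$, given $\bar b_k,a_k,\pi$. **Estimator.** Let $\Delta^s(b,a)=\int|P(b'\mid b,a)-P_s(b'\mid b,a)|\,db'\in[0,2]$ and $f(l,i)=l-c(\bar b_k,a_k)+(T-i)R_{\max}$. Let $\hat\Delta^s(b,a)$ be an unbiased randomized estimator of $\Delta^s(b,a)$ with values in $[0,2]$, and $Q_0$ a probability distribution on particle beliefs such that for $k<i<T$ the law $P_s(b_i\mid\bar b_k,\pi)$ of $b_i$ in the simplified model has a density with respect to $Q_0$, with finite $$B=\max_{k+1\le i\le T-1}B_i,\qquad B_i=\sup_{b_i}\frac{P_s(b_i\mid\bar b_k,\pi)}{Q_0(b_i)}\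 \text{(essential supremum)}.$$ For each $i\in\{k+1,\dots,T-1\}$ let $(b_i^{\Delta,n},\bar R^n_{k+1:i},\hat\Delta^{s,n}_i)$, $n=1,\dots,N_\Delta$, be i.i.d., where $b_i^{\Delta,n}\sim Q_0$, and given $b_i^{\Delta,n}$, independently, $\bar R^n_{k+1:i}$ follows the conditional law of $R_{k+1:i}$ given $b_i=b_i^{\Delta,n}$ in the simplified model, and $\hat\Delta^{s,n}_i$ is the estimate $\hat\Delta^s(b_i^{\Delta,n},\pi_i(b_i^{\Delta,n}))$; any dependence between different $i$ is allowed. Put $$\hat g(l)=\mathbf 1_{0\le f(l,k)}\Delta^s(\bar b_k,a_k)+\sum_{i=k+1}^{T-1}\frac1{N_\Delta}\sum_{n=1}^{N_\Delta}\frac{P_s(b_i^{\Delta,n}\mid\bar b_k,\pi)}{Q_0(b_i^{\Delta,n})}\,\hat\Delta^{s,n}_i\,\mathbf 1_{\bar R^n_{k+1:i}\le f(l,i)}.$$ Let $k_0\le k_1\le\dots\le k_I$ be bin edges such that $R_{k:T}\in(k_0,k_I]$ almost surely in both models, and $\hat h^+(l)=\sum_{i=1}^I\hat g(k_i)\mathbf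 1_{l\in(k_{i-1},k_i]}$. For $\eta>0$ let $$\hat F_{Y^L}(l)=\min\bigl(1,\ P_s(R_{k:T}\le l\mid\bar b_k,a_k,\pi)+\hat h^+(l)+\eta\bigr),$$ and let $\bar R^{Y^L}_j$, $j=1,\dots,N_\Delta$, be drawn i.i.d. from $\hat F_{Y^L}$ on the range $[-m,m]$ of the return, $m=R_{\max}(T-k+1)$, the mass of $\hat F_{Y^L}$ below $-m$ being placed at $-m$: $\bar R^{Y^L}_j=\inf\{l\ge -m: U_j\le\hat F_{Y^L}(l)\}$ with $U_j$ i.i.d. uniform on $[0,1]$, independent of all samples above. Define $\hat Q^{\pi,\hat h^++\eta}_{M_{P_s}}(\bar b_k,a_k,\alpha)=\hat C_\alpha(\{\bar R^{Y^L}_j\}_{j=1}^{N_\Delta})$. **Theorem.** Let $\eta>0$, $\delta\in(0,1)$, $\alpha\in(0,1)$. If $$N_\Delta\ \ge\ -\ln\!\Bigl(\frac{((\delta/4)/I)/(T-1-k)}{2}\Bigr)\frac{2B^2}{\eta^2/(T-1-k)^2},$$ then $$\mathbb P\Bigl(\hat Q^{\pi,\hat h^++\eta}_{M_{P_s}}(\bar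 b_k,a_k,\alpha)-Q^\pi_{M_P}(\bar b_k,a_k,\alpha)>v\Bigr)\le\delta,\qquad v=\frac{2R_{\max}(T-k+1)}{\alpha}\sqrt{\frac{\ln(1/(\delta/4))}{2N_\Delta}}.$$ -/

import Mathlib

open MeasureTheory ProbabilityTheory
open scoped NNReal ENNReal BigOperators

namespace RiskPOMDP

noncomputable section

/-! ### Conditional value at risk -/

/-- `CVaR_α(X) = inf_w { w + (1/α) E[(X - w)⁺] }`. -/
def cvar {Ω : Type*} [MeasurableSpace Ω] (μ : Measure Ω) (X : Ω → ℝ) (α : ℝ) : ℝ :=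
  ⨅ w : ℝ, (w + 1 / α * ∫ ω, max (X ω - w) 0 ∂μ)

/-- The sample CVaR `Ĉ_α(x₁,…,x_n) = inf_w { w + (1/(nα)) ∑ (x_i - w)⁺ }`. -/
def cvarHat {n : ℕ} (α : ℝ) (x : Fin n → ℝ) : ℝ :=
  ⨅ w : ℝ, (w + 1 / ((n : ℝ) * α) * ∑ i, max (x i - w) 0)

/-! ### Belief MDPs: policies, trajectories, returns -/

/-- A (time dependent, measurable) policy `a_t = π_t(b_t)`. -/
structure Policy (B A : Type*) [MeasurableSpace B] [MeasurableSpace A] where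
  act : ℕ → B → A
  measurable_act : ∀ t, Measurable (act t)

section BeliefMDP

variable {B A : Type*} [MeasurableSpace B] [MeasurableSpace A]

/-- The action taken `m` steps after the root time `k`: the prescribed root action `a`
for `m = 0`, afterwards the action of the policy. -/
def actionAt (π : Policy B A) (k : ℕ) (a : A) (m : ℕ) (b : B) : A :=
  if m = 0 then a else π.act (k + m) b

theorem measurable_actionAt (π : Policy B A) (k : ℕ) (a : A) (m : ℕ) :
    Measurable (actionAt π k a m) := by
  unfold actionAt
  by_cases h : m = 0
  · simp only [h, if_true]; exact measurable_const
  · simp only [h, if_false]; exact π.measurable_act _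

/-- Law of the next belief given the trajectory `(b_k,…,b_{k+m})`. -/
def stepKernel (P : Kernel (B × A) B) (π : Policy B A) (k : ℕ) (a : A) (m : ℕ) :
    Kernel (Fin (m + 1) → B) B :=
  P.comap (fun τ => (τ (Fin.last m), actionAt π k a m (τ (Fin.last m))))
    ((measurable_pi_apply _).prodMk
      ((measurable_actionAt π k a m).comp (measurable_pi_apply _)))

instance (P : Kernel (B × A) B) [IsMarkovKernel P] (π : Policy B A) (k : ℕ) (a : A) (m : ℕ) :
    IsMarkovKernel (stepKernel P π k a m) := by
  unfold stepKernel; infer_instance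

/-- Law of the trajectory `(b_k, b_{k+1}, …, b_{k+m})` started at `b_k = b` with first action
`a_k = a`, subsequent actions from `π`, and belief transition model `P`. -/
def pathLaw (P : Kernel (B × A) B) (π : Policy B A) (k : ℕ) (b : B) (a : A) :
    (m : ℕ) → Measure (Fin (m + 1) → B)
  | 0 => Measure.dirac (fun _ => b)
  | m + 1 => ((pathLaw P π k b a m) ⊗ₘ (stepKernel P π k a m)).map
      (fun p : (Fin (m + 1) → B) × B => (Fin.snoc (α := fun _ => B) p.1 p.2 : Fin (m + 2) → B))

theorem measurable_snoc (m : ℕ) :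
    Measurable (fun p : (Fin (m + 1) → B) × B =>
      (Fin.snoc (α := fun _ => B) p.1 p.2 : Fin (m + 2) → B)) := by
  refine measurable_pi_lambda _ fun i => ?_
  refine Fin.lastCases ?_ (fun j => ?_) i
  · simpa using measurable_snd
  · simp only [Fin.snoc_castSucc]
    fun_prop

instance pathLaw_isProbabilityMeasure (P : Kernel (B × A) B) [IsMarkovKernel P]
    (π : Policy B A) (k : ℕ) (b : B) (a : A) (m : ℕ) :
    IsProbabilityMeasure (pathLaw P π k b a m) := by
  induction m with
  | zero => unfold pathLaw; infer_instance
  | succ m ih =>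
    unfold pathLaw
    exact Measure.isProbabilityMeasure_map (measurable_snoc m).aemeasurable

/-- The return `R_{k+1:k+m} = ∑_{t=k+1}^{k+m} c(b_t, π_t(b_t))` along a trajectory. -/
def futureReturn (c : B → A → ℝ) (π : Policy B A) (k m : ℕ) (τ : Fin (m + 1) → B) : ℝ :=
  ∑ j : Fin m, c (τ j.succ) (π.act (k + (j + 1)) (τ j.succ))

/-- The return `R_{k:k+m} = c(b_k,a_k) + R_{k+1:k+m}`. -/
def totalReturn (c : B → A → ℝ) (π : Policy B A) (k : ℕ) (b : B) (a : A) (m : ℕ)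
    (τ : Fin (m + 1) → B) : ℝ :=
  c b a + futureReturn c π k m τ

/-- `Q^π_P(b_k,a_k,α)`: the CVaR of the return `R_{k:T}` under the transition model `P`. -/
def qValue (P : Kernel (B × A) B) (c : B → A → ℝ) (π : Policy B A) (k T : ℕ) (b : B) (a : A)
    (α : ℝ) : ℝ :=
  cvar (pathLaw P π k b a (T - k)) (totalReturn c π k b a (T - k)) α

/-- The distance `∫ |p - p_s|` (values in `[0,2]`) of two finite measures, with the densities
taken with respect to the dominating measure `μ + ν`. -/
def tvDistance (μ ν : Measure B) : ℝ :=
  ∫ x, |(μ.rnDeriv (μ + ν) x).toReal - (ν.rnDeriv (μ + ν) x).toReal| ∂(μ + ν)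

/-- `Δ^s(b,a) = ∫ |P(b'|b,a) - P_s(b'|b,a)| db'`. -/
def deltaS (P Ps : Kernel (B × A) B) (b : B) (a : A) : ℝ :=
  tvDistance (P (b, a)) (Ps (b, a))

/-- `f(l,i) = l - c(b_k,a_k) + (T-i) R_max`. -/
def shiftedLevel (ck Rmax : ℝ) (T i : ℕ) (l : ℝ) : ℝ :=
  l - ck + ((T : ℝ) - (i : ℝ)) * Rmax

/-! ### Delta beliefs and the estimators of `g` -/

/-- The law `P(b_i | b_k, π)` of the belief at time `i ≥ k`. -/
def beliefMarginal (P : Kernel (B × A) B) (π : Policy B A) (k : ℕ) (b : B) (a : A) (i : ℕ) :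
    Measure B :=
  (pathLaw P π k b a (i - k)).map (fun τ => τ (Fin.last (i - k)))

/-- The importance weight `P_s(b_i | b_k, π) / Q₀(b_i)`. -/
def importanceWeight (Ps : Kernel (B × A) B) (π : Policy B A) (k : ℕ) (b : B) (a : A)
    (Q0 : Measure B) (i : ℕ) : B → ℝ≥0∞ :=
  (beliefMarginal Ps π k b a i).rnDeriv Q0

/-- `B = max_{k+1 ≤ i ≤ T-1} sup_{b_i} P_s(b_i | b_k, π) / Q₀(b_i)`; as densities are defined up to
null sets, the supremum is the essential one. -/
def weightBound (Ps : Kernel (B × A) B) (π : Policy B A) (k T : ℕ) (b : B) (a : A)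
    (Q0 : Measure B) : ℝ≥0∞ :=
  (Finset.Ioo k T).sup fun i => essSup (importanceWeight Ps π k b a Q0 i) Q0

/-- Conditional law, in the model `Ps`, of the return `R_{k+1:i}` given the belief `b_i`. -/
def returnGivenBelief (Ps : Kernel (B × A) B) [IsMarkovKernel Ps] (c : B → A → ℝ)
    (π : Policy B A) (k : ℕ) (b : B) (a : A) (i : ℕ) : Kernel B ℝ :=
  condDistrib (futureReturn c π k (i - k)) (fun τ => τ (Fin.last (i - k)))
    (pathLaw Ps π k b a (i - k))

/-- Law of one sample `(b_i^Δ, R_{k+1:i}, Δ̂)` used at time `i`: the delta belief is drawn from `Q₀`,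
the return of a trajectory ending in it from its conditional law in the simplified model, and the
estimate `Δ̂^s(b_i^Δ, π(b_i^Δ))` from the kernel `K` describing the randomized estimator. -/
def sampleLaw (Ps : Kernel (B × A) B) [IsMarkovKernel Ps] (c : B → A → ℝ) (π : Policy B A)
    (k : ℕ) (b : B) (a : A) (Q0 : Measure B) (K : Kernel (B × A) ℝ) (i : ℕ) :
    Measure (B × ℝ × ℝ) :=
  Q0 ⊗ₘ (returnGivenBelief Ps c π k b a i ×ₖ
    K.comap (fun b' => (b', π.act i b')) (measurable_id.prodMk (π.measurable_act i)))

/-- `ĝ_i(l) = (1/N) ∑_n (P_s(b_i^n | b_k, π)/Q₀(b_i^n)) Δ̂^s(b_i^n, π(b_i^n)) 1{R^n_{k+1:i} ≤ f(l,i)}`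
for the samples `s n = (b_i^n, R^n_{k+1:i}, Δ̂^s(b_i^n, π(b_i^n)))`. -/
def gHatTerm {N : ℕ} (w : B → ℝ≥0∞) (s : Fin N → B × ℝ × ℝ) (level : ℝ) : ℝ :=
  1 / (N : ℝ) * ∑ n, (w (s n).1).toReal * (s n).2.2 * (if (s n).2.1 ≤ level then 1 else 0)

/-- `ĝ(l) = ∑_{i=k}^{T-1} ĝ_i(l)`. The summand `i = k` is the distance of the two models in the
first step from the known belief `b_k`, where nothing is sampled:
`ĝ_k(l) = 1{0 ≤ f(l,k)} Δ^s(b_k,a_k)`. -/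
def gHat {N : ℕ} (P Ps : Kernel (B × A) B) (c : B → A → ℝ) (Rmax : ℝ) (π : Policy B A)
    (k T : ℕ) (b : B) (a : A) (Q0 : Measure B) (s : ℕ → Fin N → B × ℝ × ℝ) (l : ℝ) : ℝ :=
  (if 0 ≤ shiftedLevel (c b a) Rmax T k l then deltaS P Ps b a else 0) +
    ∑ i ∈ Finset.Ioo k T,
      gHatTerm (importanceWeight Ps π k b a Q0 i) (s i) (shiftedLevel (c b a) Rmax T i l)

end BeliefMDP

/-- Upper binning of `g` over the bins `(e_{i-1}, e_i]`, `i = 1,…,I`: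
`h⁺(l) = ∑_i g(e_i) 1{l ∈ (e_{i-1}, e_i]}`. -/
def binUpper {I : ℕ} (e : Fin (I + 1) → ℝ) (g : ℝ → ℝ) (l : ℝ) : ℝ :=
  ∑ i : Fin I, g (e i.succ) * (if e i.castSucc < l ∧ l ≤ e i.succ then 1 else 0)

/-- Inverse transform: the value on `[lo, ∞)` drawn from the distribution function `F` by a uniform
variable with value `u` (mass of `F` below `lo` is placed at `lo`). -/
def quantileFrom (lo : ℝ) (F : ℝ → ℝ) (u : ℝ) : ℝ :=
  sInf {l : ℝ | lo ≤ l ∧ u ≤ F l}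

section LowerBound

variable {B A : Type*} [MeasurableSpace B] [MeasurableSpace A]

/-- `F̂_{Y^L}(l) = min(1, P_s(R_{k:T} ≤ l | b_k, a_k, π) + ĥ⁺(l) + η)`. -/
def cdfHat {N I : ℕ} (P Ps : Kernel (B × A) B) (c : B → A → ℝ) (Rmax : ℝ) (π : Policy B A)
    (k T : ℕ) (b : B) (a : A) (Q0 : Measure B) (e : Fin (I + 1) → ℝ) (η : ℝ)
    (s : ℕ → Fin N → B × ℝ × ℝ) (l : ℝ) : ℝ :=
  min 1 ((pathLaw Ps π k b a (T - k)).real {τ | totalReturn c π k b a (T - k) τ ≤ l} +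
    binUpper e (gHat P Ps c Rmax π k T b a Q0 s) l + η)

/-- The lower bound estimator `Q̂^{π, ĥ⁺+η}`: the sample CVaR of `N` draws from `F̂_{Y^L}` on the
range `[-(T-k+1) R_max, (T-k+1) R_max]` of the return, drawn by the uniform variables `u`. -/
def qLowerHat {N I : ℕ} (P Ps : Kernel (B × A) B) (c : B → A → ℝ) (Rmax : ℝ) (π : Policy B A)
    (k T : ℕ) (b : B) (a : A) (Q0 : Measure B) (e : Fin (I + 1) → ℝ) (η α : ℝ)
    (s : ℕ → Fin N → B × ℝ × ℝ) (u : Fin N → ℝ) : ℝ :=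
  cvarHat α fun j : Fin N =>
    quantileFrom (-(Rmax * ((T : ℝ) - k + 1))) (cdfHat P Ps c Rmax π k T b a Q0 e η s) (u j)

end LowerBound

/-! ### POMDPs and their particle belief MDPs -/

/-- A POMDP with state transition kernel, observation density (with respect to a reference measure
on the observation space) and state dependent cost. -/
structure POMDP (X A Z : Type*) [MeasurableSpace X] [MeasurableSpace A] [MeasurableSpace Z] where
  trans : Kernel (X × A) X
  isMarkov_trans : IsMarkovKernel trans
  obsRef : Measure Z
  sigmaFinite_obsRef : SigmaFinite obsRef
  obs : X → Z → ℝ≥0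
  measurable_obs : Measurable (Function.uncurry obs)
  lintegral_obs : ∀ x, ∫⁻ z, (obs x z : ℝ≥0∞) ∂obsRef = 1
  cost : X → A → ℝ
  measurable_cost : Measurable (Function.uncurry cost)

/-- Particle beliefs `{(x_j, w_j)}_{j=1}^N`. -/
abbrev ParticleBelief (N : ℕ) (X : Type*) : Type _ := Fin N → X × ℝ≥0

namespace POMDP

variable {X A Z : Type*} [MeasurableSpace X] [MeasurableSpace A] [MeasurableSpace Z]
  (M : POMDP X A Z) {N : ℕ}

instance : IsMarkovKernel M.trans := M.isMarkov_trans

instance : SigmaFinite M.obsRef := M.sigmaFinite_obsRef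

/-- Normalized weights `w_j / ∑ w`; uniform if all weights vanish. -/
def normWeight (b : ParticleBelief N X) (j : Fin N) : ℝ≥0 :=
  if ∑ i, (b i).2 = 0 then 1 / (N : ℝ≥0) else (b j).2 / ∑ i, (b i).2

theorem measurable_normWeight (j : Fin N) :
    Measurable fun b : ParticleBelief N X => normWeight b j := by
  unfold normWeight
  have hs : Measurable fun b : ParticleBelief N X => ∑ i, (b i).2 := by fun_prop
  refine Measurable.ite (hs (measurableSet_singleton 0)) measurable_const ?_
  exact Measurable.div (by fun_prop) hs

theorem sum_normWeight [NeZero N] (b : ParticleBelief N X) : ∑ j, normWeight b j = 1 := by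
  unfold normWeight
  by_cases h : ∑ i, (b i).2 = 0
  · have hN : (N : ℝ≥0) ≠ 0 := by exact_mod_cast NeZero.ne N
    simp [h, hN]
  · simp only [h, if_false]
    rw [← Finset.sum_div, div_self h]

/-- The cost `∑_j w_j c_x(x_j, a) / ∑_j w_j` of a particle belief. -/
def particleCost (b : ParticleBelief N X) (a : A) : ℝ :=
  (∑ j, ((b j).2 : ℝ) * M.cost (b j).1 a) / ∑ j, ((b j).2 : ℝ)

/-- Draw `x₀` from the particle belief according to the weights and propagate it: law of the state
that emits the next observation. -/
def rootKernel : Kernel (ParticleBelief N X × A) X where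
  toFun p := ∑ j, (normWeight p.1 j : ℝ≥0∞) • M.trans ((p.1 j).1, p.2)
  measurable' := by
    refine Measure.measurable_of_measurable_coe _ fun s hs => ?_
    simp only [Measure.coe_finsetSum, Finset.sum_apply, Measure.coe_smul, Pi.smul_apply,
      smul_eq_mul]
    refine Finset.measurable_sum _ fun j _ => Measurable.mul ?_ ?_
    · exact ((measurable_normWeight j).comp measurable_fst).coe_nnreal_ennreal
    · exact (M.trans.measurable_coe hs).comp (by fun_prop)

instance [NeZero N] : IsMarkovKernel (M.rootKernel (N := N)) := by
  refine ⟨fun p => ⟨?_⟩⟩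
  change (∑ j, (normWeight p.1 j : ℝ≥0∞) • M.trans ((p.1 j).1, p.2)) Set.univ = 1
  simp only [Measure.coe_finsetSum, Finset.sum_apply, Measure.coe_smul, Pi.smul_apply,
    smul_eq_mul, measure_univ, mul_one]
  exact_mod_cast sum_normWeight p.1

/-- The observation kernel `O(·|x)`. -/
def obsKernel : Kernel X Z :=
  Kernel.withDensity (Kernel.const X M.obsRef) fun x z => (M.obs x z : ℝ≥0∞)

instance : IsMarkovKernel M.obsKernel := by
  refine ⟨fun x => ⟨?_⟩⟩
  have hm : Measurable (Function.uncurry fun x z => (M.obs x z : ℝ≥0∞)) :=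
    M.measurable_obs.coe_nnreal_ennreal
  rw [obsKernel, Kernel.withDensity_apply' _ hm, setLIntegral_univ, Kernel.const_apply,
    M.lintegral_obs]

/-- Independent propagation of all particles. -/
def propagateKernel : Kernel (ParticleBelief N X × A) (Fin N → X) where
  toFun p := Measure.pi fun j => M.trans ((p.1 j).1, p.2)
  measurable' := by
    refine Measurable.measure_of_isPiSystem_of_isProbabilityMeasure generateFrom_pi.symm
      isPiSystem_pi ?_
    rintro _ ⟨s, hs, rfl⟩
    simp only [Measure.pi_pi]
    refine Finset.measurable_prod _ fun j _ => ?_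
    exact (M.trans.measurable_coe (hs j (Set.mem_univ j))).comp (by fun_prop)

instance : IsMarkovKernel (M.propagateKernel (N := N)) := by
  refine ⟨fun p => ?_⟩
  change IsProbabilityMeasure (Measure.pi fun j => M.trans ((p.1 j).1, p.2))
  infer_instance

/-- The reweighting `w'_j = w_j O(z | x'_j)` of the propagated particles. -/
def reweight (q : (ParticleBelief N X × A) × Z × (Fin N → X)) : ParticleBelief N X :=
  fun j => (q.2.2 j, (q.1.1 j).2 * M.obs (q.2.2 j) q.2.1)

theorem measurable_reweight :
    Measurable (M.reweight : (ParticleBelief N X × A) × Z × (Fin N → X) → _) := by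
  refine measurable_pi_lambda _ fun j => Measurable.prodMk (by fun_prop) ?_
  refine Measurable.mul (by fun_prop) ?_
  exact M.measurable_obs.comp (f := fun q : (ParticleBelief N X × A) × Z × (Fin N → X) =>
    (q.2.2 j, q.2.1)) (by fun_prop)

/-- The transition kernel of the particle belief MDP: one particle filter step, i.e. an observation
`z` generated from a particle drawn by its weight, independent propagation of all particles, and
reweighting by the observation density at `z`. -/
def particleKernel : Kernel (ParticleBelief N X × A) (ParticleBelief N X) :=
  (Kernel.id ×ₖ ((M.obsKernel ∘ₖ M.rootKernel) ×ₖ M.propagateKernel)).map M.reweight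

instance [NeZero N] : IsMarkovKernel (M.particleKernel (N := N)) := by
  unfold particleKernel
  exact Kernel.IsMarkovKernel.map _ M.measurable_reweight

end POMDP

end

end RiskPOMDP

/-!
Write `F` and `Fs` for the distribution functions of the return `R_{k:T}` in the model `P` and in
the simplified model `Ps`, and let `g` be the expectation of the estimator `gHat`. The proof works
for an arbitrary belief MDP with bounded measurable costs. It rests on the following facts.

* Comparison of the models (`measureReal_totalReturn_le_add_sum`): `F ≤ Fs + g`. The steps of the
  simplified model are exchanged for steps of `P` one at a time. Each exchange costs at most the
  expected distance of the transition laws, since the probability `continuationProb` of ending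
  below `l` takes values in `[0, 1]`. It costs nothing on trajectories whose return is already so
  large that it cannot fall to `l` in the remaining steps. This is the indicator in `g`.
* Concentration (`measure_exists_gHatTerm_add_le_expectedDelta`): the weighted samples are unbiased
  (`integral_sampleTerm`) and take values in `[0, 2 B]`. Hoeffding's inequality and a union bound
  over the bin edges and the times show that, outside an event of probability `δ / 8`, the
  inequality `g ≤ gHat + η` holds at every bin edge.
* Domination: `g` is monotone, so on the complement of that event the binned estimate corrects `Fs`
  to a function above `F` everywhere (`measureReal_totalReturn_le_cdfHat`). A larger distribution
  function has smaller quantiles, so each draw from `cdfHat` is at most the draw from `F` by the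
  same uniform variable. As the sample CVaR is monotone, the estimator is at most the sample CVaR
  of independent draws from `F`. The comparison is pointwise in the uniform variables.
* Concentration of the sample CVaR (`measure_lt_cvarHat_sub_cvar_le`): at a minimiser `w` of the
  objective of the true CVaR, the sample objective is a mean of independent bounded variables.
  Hoeffding's inequality bounds the failure probability by `δ / 4`.

The two failure probabilities add up to at most `δ`.
-/

namespace RiskPOMDP

/-! ### Hoeffding's inequality for sample means -/

section Hoeffding

variable {Ω : Type*} [MeasurableSpace Ω] {μ : Measure Ω} [IsProbabilityMeasure μ] {N : ℕ}
  {X : Fin N → Ω → ℝ} {x y m t : ℝ}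

theorem measure_le_sampleMean_sub_le_exp (hind : iIndepFun X μ) (hm : ∀ n, AEMeasurable (X n) μ)
    (hX : ∀ n, ∀ᵐ ω ∂μ, X n ω ∈ Set.Icc x y) (hmean : ∀ n, ∫ ω, X n ω ∂μ = m)
    (hN : 0 < N) (ht : 0 ≤ t) :
    μ {ω | t ≤ 1 / (N : ℝ) * ∑ n, X n ω - m} ≤
      ENNReal.ofReal (Real.exp (-(2 * N * t ^ 2 / (y - x) ^ 2))) := by
  have hN' : (0 : ℝ) < N := by exact_mod_cast hN
  have hind' : iIndepFun (fun n ω => X n ω - m) μ :=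
    hind.comp (fun _ z => z - m) (fun _ => by fun_prop)
  have hsub : ∀ n ∈ (Finset.univ : Finset (Fin N)),
      HasSubgaussianMGF (fun ω => X n ω - m) ((‖y - x‖₊ / 2) ^ 2) μ := fun n _ => by
    simpa only [hmean n] using hasSubgaussianMGF_of_mem_Icc (hm n) (hX n)
  have h := HasSubgaussianMGF.measure_sum_ge_le_of_iIndepFun hind' hsub
    (mul_nonneg hN'.le ht)
  have hset : {ω | t ≤ 1 / (N : ℝ) * ∑ n, X n ω - m} = {ω | N * t ≤ ∑ n, (X n ω - m)} := by
    ext ω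
    simp only [Set.mem_ofPred_eq, Finset.sum_sub_distrib, Finset.sum_const, Finset.card_univ,
      Fintype.card_fin, nsmul_eq_mul]
    rw [← mul_le_mul_iff_right₀ hN', mul_sub, ← mul_assoc, mul_one_div_cancel hN'.ne', one_mul]
  rw [hset, ← ofReal_measureReal]
  refine ENNReal.ofReal_le_ofReal (h.trans (le_of_eq ?_))
  congr 1
  simp only [Finset.sum_const, Finset.card_univ, Fintype.card_fin, nsmul_eq_mul, NNReal.coe_mul,
    NNReal.coe_natCast, NNReal.coe_pow, NNReal.coe_div, coe_nnnorm, Real.norm_eq_abs,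
    NNReal.coe_ofNat, div_pow, sq_abs]
  rcases eq_or_ne (y - x) 0 with h0 | h0
  · simp [h0]
  · field_simp

theorem measure_le_sub_sampleMean_le_exp (hind : iIndepFun X μ) (hm : ∀ n, AEMeasurable (X n) μ)
    (hX : ∀ n, ∀ᵐ ω ∂μ, X n ω ∈ Set.Icc x y) (hmean : ∀ n, ∫ ω, X n ω ∂μ = m)
    (hN : 0 < N) (ht : 0 ≤ t) :
    μ {ω | t ≤ m - 1 / (N : ℝ) * ∑ n, X n ω} ≤
      ENNReal.ofReal (Real.exp (-(2 * N * t ^ 2 / (y - x) ^ 2))) := by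
  have h := measure_le_sampleMean_sub_le_exp (X := fun n ω => -X n ω) (x := -y) (y := -x) (m := -m)
    (hind.comp (fun _ z => -z) (fun _ => measurable_neg)) (fun n => (hm n).neg)
    (fun n => (hX n).mono fun ω hω => ⟨neg_le_neg hω.2, neg_le_neg hω.1⟩)
    (fun n => by rw [integral_neg, hmean n]) hN ht
  have hxy : -x - -y = y - x := by ring
  rw [hxy] at h
  refine (measure_mono fun ω hω => ?_).trans h
  simp only [Set.mem_ofPred_eq, Finset.sum_neg_distrib] at hω ⊢
  linarith

end Hoeffding

/-! ### Conditional value at risk: minimisers, monotonicity and concentration -/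

section CVaR

variable {Ω : Type*} [MeasurableSpace Ω] {μ : Measure Ω} {α m : ℝ}

/-- The infimum defining the CVaR of a variable with values in `[-m, m]` is attained in `[-m, m]`:
the objective is continuous, decreasing on the left of the interval because `1 / α ≥ 1`, and equal
to `w` on its right. -/
theorem exists_mem_Icc_cvar_eq [IsProbabilityMeasure μ] {X : Ω → ℝ} (hX : AEMeasurable X μ)
    (hXm : ∀ᵐ ω ∂μ, X ω ∈ Set.Icc (-m) m) (hα : α ∈ Set.Ioo (0 : ℝ) 1) :
    ∃ w ∈ Set.Icc (-m) m, cvar μ X α = w + 1 / α * ∫ ω, max (X ω - w) 0 ∂μ := by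
  obtain ⟨ω₀, hω₀⟩ := hXm.exists
  have hm : -m ≤ m := hω₀.1.trans hω₀.2
  have hα1 : 1 ≤ 1 / α := by rw [le_div_iff₀ hα.1]; linarith [hα.2]
  have hint : Integrable X μ := Integrable.of_mem_Icc _ _ hX hXm
  have hint' : ∀ w : ℝ, Integrable (fun ω => max (X ω - w) 0) μ := fun w =>
    (hint.sub (integrable_const w)).pos_part
  set h : ℝ → ℝ := fun w => w + 1 / α * ∫ ω, max (X ω - w) 0 ∂μ with hh
  have hLip : LipschitzWith 1 (fun w : ℝ => ∫ ω, max (X ω - w) 0 ∂μ) := by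
    refine LipschitzWith.of_dist_le_mul fun w w' => ?_
    rw [NNReal.coe_one, one_mul, dist_eq_norm, ← integral_sub (hint' w) (hint' w'), Real.dist_eq]
    refine (norm_integral_le_of_norm_le_const (μ := μ) (C := |w - w'|)
      (.of_forall fun ω => ?_)).trans_eq ?_
    · refine (abs_max_sub_max_le_abs _ _ _).trans (le_of_eq ?_)
      rw [show X ω - w - (X ω - w') = -(w - w') by ring, abs_neg]
    · rw [probReal_univ, mul_one]
  have hcont : Continuous h := continuous_id.add (continuous_const.mul hLip.continuous)
  obtain ⟨w, hw, hmin⟩ := isCompact_Icc.exists_isMinOn (Set.nonempty_Icc.2 hm) hcont.continuousOn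
  refine ⟨w, hw, ?_⟩
  have hall : ∀ w', h w ≤ h w' := by
    intro w'
    rcases lt_or_ge w' (-m) with h1 | h1
    · have hlin : ∀ u ≤ -m, ∫ ω, max (X ω - u) 0 ∂μ = ∫ ω, X ω ∂μ - u := by
        intro u hu
        rw [integral_congr_ae (g := fun ω => X ω - u), integral_sub hint (integrable_const u)]
        · simp only [integral_const, probReal_univ, one_smul]
        · filter_upwards [hXm] with ω hω
          exact max_eq_left (by linarith [hω.1])
      refine (hmin (Set.left_mem_Icc.2 hm)).trans ?_
      simp only [hh, hlin _ le_rfl, hlin _ h1.le]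
      nlinarith
    · rcases le_or_gt w' m with h2 | h2
      · exact hmin ⟨h1, h2⟩
      · have hzero : ∀ u, m ≤ u → ∫ ω, max (X ω - u) 0 ∂μ = 0 := by
          intro u hu
          rw [integral_congr_ae (g := fun _ => (0 : ℝ)), integral_zero]
          filter_upwards [hXm] with ω hω
          exact max_eq_right (by linarith [hω.2])
        refine (hmin (Set.right_mem_Icc.2 hm)).trans ?_
        simp only [hh, hzero _ le_rfl, hzero _ h2.le]
        linarith
  exact le_antisymm (ciInf_le ⟨h w, by rintro _ ⟨w', rfl⟩; exact hall w'⟩ w) (le_ciInf hall)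

theorem bddBelow_range_cvarHat_objective {n : ℕ} (hn : 0 < n) (hα : α ∈ Set.Ioo (0 : ℝ) 1)
    (x : Fin n → ℝ) :
    BddBelow (Set.range fun w : ℝ => w + 1 / ((n : ℝ) * α) * ∑ i, max (x i - w) 0) := by
  have hn' : (0 : ℝ) < n := by exact_mod_cast hn
  -- The sample mean is a lower bound, since `1 / α ≥ 1` and `y⁺ ≥ y`.
  refine ⟨1 / (n : ℝ) * ∑ i, x i, ?_⟩
  rintro _ ⟨w, rfl⟩
  have h1 : ∑ i, x i - n * w ≤ ∑ i, max (x i - w) 0 := by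
    calc ∑ i, x i - n * w = ∑ i, (x i - w) := by simp
      _ ≤ _ := Finset.sum_le_sum fun i _ => le_max_left _ _
  have h0 : 0 ≤ ∑ i, max (x i - w) 0 := Finset.sum_nonneg fun i _ => le_max_right _ _
  have h2 : 1 / (n : ℝ) ≤ 1 / (n * α) :=
    one_div_le_one_div_of_le (mul_pos hn' hα.1) (by nlinarith [hα.2])
  have h3 : 1 / (n : ℝ) * (∑ i, x i - n * w) = 1 / (n : ℝ) * ∑ i, x i - w := by
    field_simp
  have h4 := mul_le_mul_of_nonneg_left h1 (by positivity : 0 ≤ 1 / (n : ℝ))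
  have h5 := mul_le_mul_of_nonneg_right h2 h0
  simp only
  linarith

theorem cvarHat_mono {n : ℕ} (hn : 0 < n) (hα : α ∈ Set.Ioo (0 : ℝ) 1) {x y : Fin n → ℝ}
    (hxy : ∀ i, x i ≤ y i) : cvarHat α x ≤ cvarHat α y := by
  refine ciInf_mono (bddBelow_range_cvarHat_objective hn hα x) fun w => ?_
  have := hα.1
  gcongr with i
  exact hxy i

/-- One-sided concentration of the sample CVaR. Evaluating the sample objective at a minimiser `w`
of the true objective bounds the sample CVaR by `w` plus a mean of independent variables with
values in `[0, 2m]`. -/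
theorem measure_lt_cvarHat_sub_cvar_le [IsProbabilityMeasure μ] {N : ℕ} (hN : 0 < N)
    {X : Fin N → Ω → ℝ} (hind : iIndepFun X μ) {ν : Measure ℝ} [IsProbabilityMeasure ν]
    (hlaw : ∀ n, HasLaw (X n) ν μ) (hν : ∀ᵐ x ∂ν, x ∈ Set.Icc (-m) m)
    (hα : α ∈ Set.Ioo (0 : ℝ) 1) {ε : ℝ} (hε0 : 0 < ε) (hε1 : ε ≤ 1) :
    μ {ω | 2 * m / α * Real.sqrt (Real.log (1 / ε) / (2 * N)) <
      cvarHat α (fun n => X n ω) - cvar ν id α} ≤ ENNReal.ofReal ε := by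
  have hN' : (0 : ℝ) < N := by exact_mod_cast hN
  have hα0 := hα.1.ne'
  obtain ⟨w, hw, hcv⟩ := exists_mem_Icc_cvar_eq (μ := ν) (X := id) aemeasurable_id hν hα
  have hm : 0 ≤ m := by linarith [hw.1, hw.2]
  have hX : ∀ n, ∀ᵐ ω ∂μ, X n ω ∈ Set.Icc (-m) m := fun n =>
    ((hlaw n).ae_iff (measurableSet_setOfPred.1 measurableSet_Icc)).2 hν
  have hmeas : Measurable fun x : ℝ => max (x - w) 0 := by fun_prop
  have hpos : ∀ n, ∀ᵐ ω ∂μ, max (X n ω - w) 0 ∈ Set.Icc 0 (2 * m) := fun n =>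
    (hX n).mono fun ω hω =>
      ⟨le_max_right _ _, max_le (by linarith [hω.2, hw.1]) (by linarith [hω.1, hω.2])⟩
  set t : ℝ := 2 * m * Real.sqrt (Real.log (1 / ε) / (2 * N)) with ht
  have hsub : {ω | 2 * m / α * Real.sqrt (Real.log (1 / ε) / (2 * N)) <
      cvarHat α (fun n => X n ω) - cvar ν id α} ⊆
      {ω | t < 1 / (N : ℝ) * ∑ n, max (X n ω - w) 0 - ∫ x, max (x - w) 0 ∂ν} := by
    intro ω hω
    simp only [Set.mem_ofPred_eq] at hω ⊢
    have hle : cvarHat α (fun n => X n ω) ≤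
        w + 1 / ((N : ℝ) * α) * ∑ i, max (X i ω - w) 0 :=
      ciInf_le (bddBelow_range_cvarHat_objective hN hα _) w
    rw [hcv] at hω
    have h1 : 2 * m / α * Real.sqrt (Real.log (1 / ε) / (2 * N)) <
        1 / ((N : ℝ) * α) * ∑ i, max (X i ω - w) 0 - 1 / α * ∫ x, max (x - w) 0 ∂ν := by
      simp only [id] at hω
      linarith
    have h2 := mul_lt_mul_of_pos_left h1 hα.1
    have h3 : α * (1 / ((N : ℝ) * α) * ∑ i, max (X i ω - w) 0 -
        1 / α * ∫ x, max (x - w) 0 ∂ν) =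
        1 / (N : ℝ) * ∑ i, max (X i ω - w) 0 - ∫ x, max (x - w) 0 ∂ν := by
      field_simp
    have h4 : α * (2 * m / α * Real.sqrt (Real.log (1 / ε) / (2 * N))) = t := by
      rw [ht]
      field_simp
    rwa [h3, h4] at h2
  refine (measure_mono hsub).trans ?_
  rcases hm.eq_or_lt with rfl | hm
  · -- All variables vanish almost surely, so the event is null.
    refine (le_of_eq ?_).trans zero_le
    rw [measure_eq_zero_iff_ae_notMem]
    filter_upwards [ae_all_iff.2 hpos] with ω hω hlt
    have h0 : ∑ n, max (X n ω - w) 0 = 0 :=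
      Finset.sum_eq_zero fun n _ => le_antisymm (by simpa using (hω n).2) (hω n).1
    have h1 : 0 ≤ ∫ x, max (x - w) 0 ∂ν := integral_nonneg fun _ => le_max_right _ _
    simp only [h0, ht] at hlt
    linarith
  · have hlog : 0 ≤ Real.log (1 / ε) := Real.log_nonneg ((one_le_div hε0).2 hε1)
    have h := measure_le_sampleMean_sub_le_exp (μ := μ) (X := fun n ω => max (X n ω - w) 0)
      (x := 0) (y := 2 * m) (m := ∫ x, max (x - w) 0 ∂ν) (t := t)
      (hind.comp (fun _ x => max (x - w) 0) (fun _ => hmeas))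
      (fun n => hmeas.comp_aemeasurable (hlaw n).aemeasurable) hpos
      (fun n => (hlaw n).integral_comp hmeas.aestronglyMeasurable) hN (by positivity)
    have hexp : Real.exp (-(2 * N * t ^ 2 / (2 * m - 0) ^ 2)) = ε := by
      have h5 : 2 * N * t ^ 2 / (2 * m - 0) ^ 2 = -Real.log ε := by
        rw [ht, mul_pow, Real.sq_sqrt (by positivity), Real.log_div one_ne_zero hε0.ne',
          Real.log_one]
        field_simp
        ring
      rw [h5, neg_neg, Real.exp_log hε0]
    rw [hexp] at h
    refine (measure_mono fun ω hω => ?_).trans h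
    rw [Set.mem_ofPred_eq] at hω ⊢
    exact hω.le

end CVaR

/-! ### Inverse transform sampling -/

section Quantile

variable {lo hi : ℝ}

theorem bddBelow_quantile_set (F : ℝ → ℝ) (u : ℝ) : BddBelow {l : ℝ | lo ≤ l ∧ u ≤ F l} :=
  ⟨lo, fun _ hl => hl.1⟩

theorem quantileFrom_set_nonempty {ν : Measure ℝ} [IsProbabilityMeasure ν]
    (hν : ∀ᵐ x ∂ν, x ∈ Set.Icc lo hi) {u : ℝ} (hu : u ≤ 1) :
    {l : ℝ | lo ≤ l ∧ u ≤ cdf ν l}.Nonempty := by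
  refine ⟨max lo hi, le_max_left _ _, hu.trans (le_of_eq ?_)⟩
  rw [cdf_eq_real, measureReal_def, (prob_compl_eq_zero_iff measurableSet_Iic).1,
    ENNReal.toReal_one]
  exact ae_iff.1 (hν.mono fun x hx => hx.2.trans (le_max_right lo hi))

theorem le_quantileFrom_cdf {ν : Measure ℝ} [IsProbabilityMeasure ν]
    (hν : ∀ᵐ x ∂ν, x ∈ Set.Icc lo hi) {u : ℝ} (hu : u ≤ 1) : lo ≤ quantileFrom lo (cdf ν) u :=
  le_csInf (quantileFrom_set_nonempty hν hu) fun _ hl => hl.1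

/-- The Galois connection between quantiles and a right-continuous distribution function. -/
theorem quantileFrom_cdf_le_iff {ν : Measure ℝ} [IsProbabilityMeasure ν]
    (hν : ∀ᵐ x ∂ν, x ∈ Set.Icc lo hi) {u l : ℝ} (hu : u ≤ 1) (hl : lo ≤ l) :
    quantileFrom lo (cdf ν) u ≤ l ↔ u ≤ cdf ν l := by
  refine ⟨fun h => ?_, fun h => csInf_le (bddBelow_quantile_set _ _) ⟨hl, h⟩⟩
  refine ge_of_tendsto (x := nhdsWithin l (Set.Ioi l)) (b := u)
    (((cdf ν).right_continuous l).tendsto.mono_left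
      (nhdsWithin_mono _ Set.Ioi_subset_Ici_self)) ?_
  filter_upwards [self_mem_nhdsWithin] with x hx
  obtain ⟨s, hs, hsx⟩ := exists_lt_of_csInf_lt (quantileFrom_set_nonempty hν hu)
    (lt_of_le_of_lt h hx)
  exact hs.2.trans (monotone_cdf ν hsx.le)

/-- Raising the distribution function lowers its quantiles. No regularity of the larger function
is needed. -/
theorem quantileFrom_le_quantileFrom_cdf {ν : Measure ℝ} [IsProbabilityMeasure ν]
    (hν : ∀ᵐ x ∂ν, x ∈ Set.Icc lo hi) {F : ℝ → ℝ} (hF : ∀ l, cdf ν l ≤ F l) {u : ℝ} (hu : u ≤ 1) :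
    quantileFrom lo F u ≤ quantileFrom lo (cdf ν) u :=
  csInf_le_csInf (bddBelow_quantile_set _ _) (quantileFrom_set_nonempty hν hu)
    fun l hl => ⟨hl.1, hl.2.trans (hF l)⟩

theorem monotone_quantileFrom_cdf_min_one {ν : Measure ℝ} [IsProbabilityMeasure ν]
    (hν : ∀ᵐ x ∂ν, x ∈ Set.Icc lo hi) :
    Monotone fun u => quantileFrom lo (cdf ν) (min u 1) := fun _ _ huv =>
  (quantileFrom_cdf_le_iff hν (min_le_right _ _) (le_quantileFrom_cdf hν (min_le_right _ _))).2
    ((min_le_min_right 1 huv).trans ((quantileFrom_cdf_le_iff hν (min_le_right _ _)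
      (le_quantileFrom_cdf hν (min_le_right _ _))).1 le_rfl))

/-- Inverse transform sampling. The argument is truncated at `1`, where the set of candidate
quantiles may become empty, so that the map is monotone on all of `ℝ`. -/
theorem hasLaw_quantileFrom_cdf {ν : Measure ℝ} [IsProbabilityMeasure ν]
    (hν : ∀ᵐ x ∂ν, x ∈ Set.Icc lo hi) :
    HasLaw (fun u => quantileFrom lo (cdf ν) (min u 1)) ν
      (volume.restrict (Set.Icc (0 : ℝ) 1)) := by
  have hmeas := (monotone_quantileFrom_cdf_min_one hν).measurable
  refine ⟨hmeas.aemeasurable, ?_⟩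
  have : IsProbabilityMeasure (volume.restrict (Set.Icc (0 : ℝ) 1)) := ⟨by simp⟩
  have := Measure.isProbabilityMeasure_map (μ := volume.restrict (Set.Icc (0 : ℝ) 1))
    hmeas.aemeasurable
  refine Measure.ext_of_Iic _ _ fun l => ?_
  rw [Measure.map_apply hmeas measurableSet_Iic,
    Measure.restrict_apply (hmeas measurableSet_Iic)]
  rcases lt_or_ge l lo with hl | hl
  · rw [measure_eq_zero_iff_ae_notMem.2, measure_eq_zero_iff_ae_notMem.2]
    · filter_upwards [hν] with x hx h
      exact absurd (hx.1.trans h) (not_le.2 hl)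
    · exact .of_forall fun u hu => absurd
        ((le_quantileFrom_cdf hν (min_le_right u 1)).trans hu.1) (not_le.2 hl)
  · have hset : (fun u => quantileFrom lo (cdf ν) (min u 1)) ⁻¹' Set.Iic l ∩ Set.Icc 0 1 =
        Set.Icc 0 (cdf ν l) := by
      ext u
      simp only [Set.mem_inter_iff, Set.mem_preimage, Set.mem_Iic, Set.mem_Icc]
      rw [quantileFrom_cdf_le_iff hν (min_le_right _ _) hl]
      have h1 := cdf_le_one ν l
      constructor
      · rintro ⟨h, h0, hu⟩
        exact ⟨h0, by rwa [min_eq_left hu] at h⟩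
      · rintro ⟨h0, h⟩
        exact ⟨(min_le_left _ _).trans h, h0, h.trans h1⟩
    rw [hset, Real.volume_Icc, sub_zero, ofReal_cdf]

end Quantile

/-! ### Comparison of the return distributions of two belief transition models -/

section Comparison

variable {B A : Type*} [MeasurableSpace B] [MeasurableSpace A]

theorem integral_sub_integral_le_tvDistance (μ ν : Measure B) [IsFiniteMeasure μ]
    [IsFiniteMeasure ν] {f : B → ℝ} (hf : Measurable f) (hf01 : ∀ x, f x ∈ Set.Icc (0 : ℝ) 1) :
    ∫ x, f x ∂μ - ∫ x, f x ∂ν ≤ tvDistance μ ν := by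
  have hμ : μ ≪ μ + ν := Measure.absolutelyContinuous_of_le (Measure.le_add_right le_rfl)
  have hν : ν ≪ μ + ν := Measure.absolutelyContinuous_of_le (Measure.le_add_left le_rfl)
  have hi : ∀ ρ : Measure B, IsFiniteMeasure ρ → Integrable f ρ := fun ρ _ =>
    Integrable.of_mem_Icc 0 1 hf.aemeasurable (.of_forall hf01)
  have hiμ := (integrable_rnDeriv_smul_iff hμ).2 (hi μ inferInstance)
  have hiν := (integrable_rnDeriv_smul_iff hν).2 (hi ν inferInstance)
  rw [← integral_rnDeriv_smul hμ, ← integral_rnDeriv_smul hν, ← integral_sub hiμ hiν]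
  refine integral_mono (hiμ.sub hiν)
    (Measure.integrable_toReal_rnDeriv.sub Measure.integrable_toReal_rnDeriv).abs fun x => ?_
  simp only [smul_eq_mul, ← sub_mul]
  refine (mul_le_mul_of_nonneg_right (le_abs_self _) (hf01 x).1).trans ?_
  exact mul_le_of_le_one_right (abs_nonneg _) (hf01 x).2

variable {P Ps : Kernel (B × A) B} {c : B → A → ℝ} {Rmax : ℝ} {π : Policy B A} {k : ℕ} {b : B}
  {a : A} {l : ℝ}

theorem measurable_futureReturn (hc : Measurable (Function.uncurry c)) (m : ℕ) :
    Measurable (futureReturn c π k m) := by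
  unfold futureReturn
  refine Finset.measurable_sum _ fun j _ => ?_
  have hj : Measurable fun τ : Fin (m + 1) → B => τ j.succ := measurable_pi_apply _
  exact hc.comp (hj.prodMk ((π.measurable_act (k + (j + 1))).comp hj))

theorem measurable_totalReturn (hc : Measurable (Function.uncurry c)) (m : ℕ) :
    Measurable (totalReturn c π k b a m) :=
  (measurable_futureReturn hc m).const_add _

theorem totalReturn_snoc (m : ℕ) (τ : Fin (m + 1) → B) (b' : B) :
    totalReturn c π k b a (m + 1) (Fin.snoc (α := fun _ => B) τ b') =
      totalReturn c π k b a m τ + c b' (π.act (k + (m + 1)) b') := by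
  unfold totalReturn futureReturn
  simp only [Fin.sum_univ_castSucc, add_assoc, Fin.succ_last, Fin.snoc_last, Fin.succ_castSucc,
    Fin.snoc_castSucc, Fin.val_castSucc, Fin.val_last]

theorem abs_futureReturn_le (hcR : ∀ b a, |c b a| ≤ Rmax) (m : ℕ) (τ : Fin (m + 1) → B) :
    |futureReturn c π k m τ| ≤ m * Rmax := by
  refine (Finset.abs_sum_le_sum_abs _ _).trans ((Finset.sum_le_sum fun j _ => hcR _ _).trans ?_)
  simp

theorem integral_pathLaw_succ [IsMarkovKernel P] (m : ℕ) {f : (Fin (m + 2) → B) → ℝ}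
    (hf : Measurable f) (hf01 : ∀ x, f x ∈ Set.Icc (0 : ℝ) 1) :
    ∫ τ, f τ ∂(pathLaw P π k b a (m + 1)) =
      ∫ τ, ∫ b', f (Fin.snoc (α := fun _ => B) τ b') ∂(stepKernel P π k a m τ)
        ∂(pathLaw P π k b a m) := by
  rw [pathLaw, integral_map (measurable_snoc m).aemeasurable hf.aestronglyMeasurable,
    Measure.integral_compProd]
  exact Integrable.of_mem_Icc 0 1 (hf.comp (measurable_snoc m)).aemeasurable
    (.of_forall fun _ => hf01 _)

/-- The probability, in the model `P`, that the return of a trajectory continued for `r` further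
steps after `(b_k, …, b_{k+m})` is at most `l`. -/
noncomputable def continuationProb (P : Kernel (B × A) B) (c : B → A → ℝ) (π : Policy B A) (k : ℕ)
    (b : B) (a : A) (l : ℝ) : (r m : ℕ) → (Fin (m + 1) → B) → ℝ
  | 0, m, τ => (Set.Iic l).indicator 1 (totalReturn c π k b a m τ)
  | r + 1, m, τ => ∫ b', continuationProb P c π k b a l r (m + 1)
      (Fin.snoc (α := fun _ => B) τ b') ∂(stepKernel P π k a m τ)

theorem measurable_continuationProb [IsMarkovKernel P] (hc : Measurable (Function.uncurry c))
    (r m : ℕ) : Measurable (continuationProb P c π k b a l r m) := by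
  induction r generalizing m with
  | zero =>
    exact (measurable_one.indicator measurableSet_Iic).comp (measurable_totalReturn hc m)
  | succ r ih =>
    exact (StronglyMeasurable.integral_kernel_prod_right' (κ := stepKernel P π k a m)
      ((ih (m + 1)).comp (measurable_snoc m)).stronglyMeasurable).measurable

theorem continuationProb_mem_Icc [IsMarkovKernel P] (hc : Measurable (Function.uncurry c))
    (r m : ℕ) (τ : Fin (m + 1) → B) : continuationProb P c π k b a l r m τ ∈ Set.Icc (0 : ℝ) 1 := by
  induction r generalizing m with
  | zero =>
    rw [continuationProb]
    by_cases h : totalReturn c π k b a m τ ∈ Set.Iic l <;> simp [h]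
  | succ r ih =>
    rw [continuationProb]
    refine ⟨integral_nonneg fun b' => (ih _ _).1, ?_⟩
    refine (integral_mono (Integrable.of_mem_Icc 0 1 ?_ (.of_forall fun _ => ih _ _))
      (integrable_const 1) fun b' => (ih _ _).2).trans (by simp)
    exact ((measurable_continuationProb hc r (m + 1)).comp
      ((measurable_snoc m).comp measurable_prodMk_left)).aemeasurable

/-- A trajectory whose return exceeds `l + r * Rmax` cannot come down to `l` in `r` steps. -/
theorem continuationProb_eq_zero (hcR : ∀ b a, |c b a| ≤ Rmax) (r m : ℕ) (τ : Fin (m + 1) → B)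
    (h : l + r * Rmax < totalReturn c π k b a m τ) :
    continuationProb P c π k b a l r m τ = 0 := by
  induction r generalizing m with
  | zero =>
    rw [continuationProb, Set.indicator_of_notMem]
    simpa using h
  | succ r ih =>
    rw [continuationProb, integral_congr_ae (g := fun _ => (0 : ℝ)), integral_zero]
    refine .of_forall fun b' => ih _ _ ?_
    rw [totalReturn_snoc]
    have := (abs_le.1 (hcR b' (π.act (k + (m + 1)) b'))).1
    push_cast at h
    linarith

theorem integral_continuationProb_zero (Q : Kernel (B × A) B) [IsMarkovKernel Q]
    (hc : Measurable (Function.uncurry c)) (m : ℕ) :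
    ∫ τ, continuationProb P c π k b a l 0 m τ ∂(pathLaw Q π k b a m) =
      (pathLaw Q π k b a m).real {τ | totalReturn c π k b a m τ ≤ l} := by
  have hs : MeasurableSet {τ | totalReturn c π k b a m τ ≤ l} :=
    measurable_totalReturn hc m measurableSet_Iic
  rw [← integral_indicator_one hs]
  rfl

theorem integral_continuationProb [IsMarkovKernel P] (hc : Measurable (Function.uncurry c))
    (r m n : ℕ) (hn : m + r = n) :
    ∫ τ, continuationProb P c π k b a l r m τ ∂(pathLaw P π k b a m) =
      (pathLaw P π k b a n).real {τ | totalReturn c π k b a n τ ≤ l} := by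
  induction r generalizing m with
  | zero =>
    obtain rfl : m = n := hn
    exact integral_continuationProb_zero P hc m
  | succ r ih =>
    rw [← ih (m + 1) (by omega), integral_pathLaw_succ m (measurable_continuationProb hc _ _)
      (continuationProb_mem_Icc hc _ _)]
    rfl

/-- The expectation, in the simplified model, of the distance of the two models at the `m`-th belief
after the root, restricted to trajectories whose future return up to then is at most `level`. -/
noncomputable def expectedDelta (P Ps : Kernel (B × A) B) (c : B → A → ℝ) (π : Policy B A) (k : ℕ)
    (b : B) (a : A) (m : ℕ) (level : ℝ) : ℝ :=
  ∫ τ, deltaS P Ps (τ (Fin.last m)) (actionAt π k a m (τ (Fin.last m))) *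
    (Set.Iic level).indicator 1 (futureReturn c π k m τ) ∂(pathLaw Ps π k b a m)

theorem measurable_expectedDelta_integrand (hc : Measurable (Function.uncurry c))
    (hd : Measurable (Function.uncurry (deltaS P Ps))) (m : ℕ) (level : ℝ) :
    Measurable fun τ : Fin (m + 1) → B =>
      deltaS P Ps (τ (Fin.last m)) (actionAt π k a m (τ (Fin.last m))) *
        (Set.Iic level).indicator (1 : ℝ → ℝ) (futureReturn c π k m τ) := by
  have hlast : Measurable fun τ : Fin (m + 1) → B => τ (Fin.last m) := measurable_pi_apply _
  have h1 := hd.comp (hlast.prodMk ((measurable_actionAt π k a m).comp hlast))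
  have h2 : Measurable fun τ : Fin (m + 1) → B =>
      (Set.Iic level).indicator (1 : ℝ → ℝ) (futureReturn c π k m τ) :=
    (measurable_one.indicator measurableSet_Iic).comp (measurable_futureReturn hc m)
  exact h1.mul h2

theorem expectedDelta_integrand_mem_Icc (hd02 : ∀ b a, deltaS P Ps b a ∈ Set.Icc (0 : ℝ) 2)
    (m : ℕ) (level : ℝ) (τ : Fin (m + 1) → B) :
    deltaS P Ps (τ (Fin.last m)) (actionAt π k a m (τ (Fin.last m))) *
        (Set.Iic level).indicator (1 : ℝ → ℝ) (futureReturn c π k m τ) ∈ Set.Icc (0 : ℝ) 2 := by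
  have h := hd02 (τ (Fin.last m)) (actionAt π k a m (τ (Fin.last m)))
  by_cases h' : futureReturn c π k m τ ∈ Set.Iic level
  · simpa [h'] using h
  · simp [h']

theorem integrable_expectedDelta_integrand [IsMarkovKernel Ps]
    (hc : Measurable (Function.uncurry c))
    (hd : Measurable (Function.uncurry (deltaS P Ps)))
    (hd02 : ∀ b a, deltaS P Ps b a ∈ Set.Icc (0 : ℝ) 2) (m : ℕ) (level : ℝ) :
    Integrable (fun τ : Fin (m + 1) → B =>
      deltaS P Ps (τ (Fin.last m)) (actionAt π k a m (τ (Fin.last m))) *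
        (Set.Iic level).indicator (1 : ℝ → ℝ) (futureReturn c π k m τ)) (pathLaw Ps π k b a m) :=
  Integrable.of_mem_Icc 0 2 (measurable_expectedDelta_integrand hc hd m level).aemeasurable
    (.of_forall (expectedDelta_integrand_mem_Icc hd02 m level))

theorem expectedDelta_mono [IsMarkovKernel Ps] (hc : Measurable (Function.uncurry c))
    (hd : Measurable (Function.uncurry (deltaS P Ps)))
    (hd02 : ∀ b a, deltaS P Ps b a ∈ Set.Icc (0 : ℝ) 2) (m : ℕ) :
    Monotone (expectedDelta P Ps c π k b a m) := fun x y hxy => by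
  refine integral_mono (integrable_expectedDelta_integrand hc hd hd02 m x)
    (integrable_expectedDelta_integrand hc hd hd02 m y) fun τ => ?_
  exact mul_le_mul_of_nonneg_left (Set.indicator_le_indicator_of_subset (Set.Iic_subset_Iic.2 hxy)
    (fun _ => zero_le_one) _) (hd02 _ _).1

/-- Replacing `P` by `Ps` in one step changes the probability of a small return by at most the
expected distance of the two models in that step. Only trajectories from which a small return is
still possible contribute. -/
theorem integral_continuationProb_succ_le [IsMarkovKernel P] [IsMarkovKernel Ps]
    (hc : Measurable (Function.uncurry c)) (hcR : ∀ b a, |c b a| ≤ Rmax)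
    (hd : Measurable (Function.uncurry (deltaS P Ps)))
    (hd02 : ∀ b a, deltaS P Ps b a ∈ Set.Icc (0 : ℝ) 2) (r m : ℕ) :
    ∫ τ, continuationProb P c π k b a l (r + 1) m τ ∂(pathLaw Ps π k b a m) ≤
      ∫ τ, continuationProb P c π k b a l r (m + 1) τ ∂(pathLaw Ps π k b a (m + 1)) +
        expectedDelta P Ps c π k b a m (l - c b a + ((r : ℝ) + 1) * Rmax) := by
  have hV := measurable_continuationProb (P := P) (π := π) (k := k) (b := b) (a := a) (l := l) hc
    r (m + 1)
  have hV01 := continuationProb_mem_Icc (P := P) (π := π) (k := k) (b := b) (a := a) (l := l) hc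
    r (m + 1)
  have hsnoc : ∀ τ : Fin (m + 1) → B, Measurable fun b' : B =>
      (Fin.snoc (α := fun _ => B) τ b' : Fin (m + 2) → B) := fun τ =>
    (measurable_snoc m).comp measurable_prodMk_left
  have hstep : ∀ (Q : Kernel (B × A) B) [IsMarkovKernel Q],
      Integrable (fun τ => ∫ b', continuationProb P c π k b a l r (m + 1)
        (Fin.snoc (α := fun _ => B) τ b') ∂(stepKernel Q π k a m τ)) (pathLaw Ps π k b a m) := by
    intro Q _
    refine Integrable.of_mem_Icc 0 1 (StronglyMeasurable.integral_kernel_prod_right'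
      (κ := stepKernel Q π k a m)
      (hV.comp (measurable_snoc m)).stronglyMeasurable).measurable.aemeasurable
      (.of_forall fun τ => ⟨integral_nonneg fun _ => (hV01 _).1, ?_⟩)
    refine (integral_mono (Integrable.of_mem_Icc 0 1 (hV.comp (hsnoc τ)).aemeasurable
      (.of_forall fun _ => hV01 _)) (integrable_const 1) fun b' => (hV01 _).2).trans (by simp)
  rw [integral_pathLaw_succ m hV hV01, expectedDelta,
    ← integral_add (hstep Ps) (integrable_expectedDelta_integrand hc hd hd02 m _)]
  refine integral_mono (hstep P)
    ((hstep Ps).add (integrable_expectedDelta_integrand hc hd hd02 m _)) fun τ => ?_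
  rw [← sub_le_iff_le_add']
  by_cases h : futureReturn c π k m τ ∈ Set.Iic (l - c b a + ((r : ℝ) + 1) * Rmax)
  · rw [Set.indicator_of_mem h, Pi.one_apply, mul_one]
    exact integral_sub_integral_le_tvDistance _ _ (hV.comp (hsnoc τ)) fun _ => hV01 _
  · rw [Set.indicator_of_notMem h, mul_zero]
    have hzero : ∀ b', continuationProb P c π k b a l r (m + 1)
        (Fin.snoc (α := fun _ => B) τ b') = 0 := by
      intro b'
      refine continuationProb_eq_zero hcR _ _ _ ?_
      rw [totalReturn_snoc, totalReturn]
      have := (abs_le.1 (hcR b' (π.act (k + (m + 1)) b'))).1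
      rw [Set.mem_Iic, not_le] at h
      linarith
    simp [continuationProb, hzero]

/-- Telescoping over the steps at which the simplified model is replaced by `P`. -/
theorem integral_continuationProb_le_add_sum [IsMarkovKernel P] [IsMarkovKernel Ps]
    (hc : Measurable (Function.uncurry c)) (hcR : ∀ b a, |c b a| ≤ Rmax)
    (hd : Measurable (Function.uncurry (deltaS P Ps)))
    (hd02 : ∀ b a, deltaS P Ps b a ∈ Set.Icc (0 : ℝ) 2) (r m n : ℕ) (hn : m + r = n) :
    ∫ τ, continuationProb P c π k b a l r m τ ∂(pathLaw Ps π k b a m) ≤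
      (pathLaw Ps π k b a n).real {τ | totalReturn c π k b a n τ ≤ l} +
        ∑ i ∈ Finset.Ico m n,
          expectedDelta P Ps c π k b a i (l - c b a + ((n : ℝ) - i) * Rmax) := by
  induction r generalizing m with
  | zero =>
    obtain rfl : m = n := hn
    simp [integral_continuationProb_zero Ps hc]
  | succ r ih =>
    have ih := ih (m + 1) (by omega)
    rw [Finset.sum_eq_sum_Ico_succ_bot (by omega)]
    have hs := integral_continuationProb_succ_le (P := P) (Ps := Ps) (π := π) (k := k) (b := b)
      (a := a) (l := l) hc hcR hd hd02 r m
    have h3 : (n : ℝ) - m = (r : ℝ) + 1 := by rw [← hn]; push_cast; ring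
    rw [h3]
    linarith

theorem measureReal_totalReturn_le_add_sum [IsMarkovKernel P] [IsMarkovKernel Ps]
    (hc : Measurable (Function.uncurry c)) (hcR : ∀ b a, |c b a| ≤ Rmax)
    (hd : Measurable (Function.uncurry (deltaS P Ps)))
    (hd02 : ∀ b a, deltaS P Ps b a ∈ Set.Icc (0 : ℝ) 2) {T : ℕ} (hkT : k < T) (l : ℝ) :
    (pathLaw P π k b a (T - k)).real {τ | totalReturn c π k b a (T - k) τ ≤ l} ≤
      (pathLaw Ps π k b a (T - k)).real {τ | totalReturn c π k b a (T - k) τ ≤ l} +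
        ((if 0 ≤ shiftedLevel (c b a) Rmax T k l then deltaS P Ps b a else 0) +
          ∑ i ∈ Finset.Ioo k T,
            expectedDelta P Ps c π k b a (i - k) (shiftedLevel (c b a) Rmax T i l)) := by
  have h := integral_continuationProb_le_add_sum (P := P) (Ps := Ps) (π := π) (k := k) (b := b)
    (a := a) (l := l) hc hcR hd hd02 (T - k) 0 (T - k) (zero_add _)
  have h0 : pathLaw Ps π k b a 0 = pathLaw P π k b a 0 := rfl
  rw [h0, integral_continuationProb hc (T - k) 0 (T - k) (zero_add _)] at h
  refine h.trans (le_of_eq ?_)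
  have hcast : ((T - k : ℕ) : ℝ) = (T : ℝ) - k := Nat.cast_sub hkT.le
  rw [Finset.sum_eq_sum_Ico_succ_bot (by omega)]
  congr 2
  · have hset : (pathLaw Ps π k b a 0) = Measure.dirac fun _ => b := rfl
    rw [expectedDelta, hset, integral_dirac' _ _
      (measurable_expectedDelta_integrand hc hd 0 _).stronglyMeasurable]
    simp only [futureReturn, actionAt, shiftedLevel, hcast, Set.indicator_apply]
    simp
    congr
  · refine Finset.sum_nbij' (fun m => m + k) (fun i => i - k) ?_ ?_ ?_ ?_ ?_
    · intro m hm
      simp only [Finset.mem_Ico, Finset.mem_Ioo] at hm ⊢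
      omega
    · intro i hi
      simp only [Finset.mem_Ico, Finset.mem_Ioo] at hi ⊢
      omega
    · intro m _
      simp
    · intro i hi
      simp only [Finset.mem_Ioo] at hi
      omega
    · intro m _
      rw [Nat.add_sub_cancel, hcast, shiftedLevel]
      push_cast
      ring_nf

end Comparison

/-! ### The importance sampling estimator -/

section Estimator

variable {B A : Type*} [MeasurableSpace B] [MeasurableSpace A]
  {P Ps : Kernel (B × A) B} {c : B → A → ℝ} {π : Policy B A} {k T : ℕ} {b : B} {a : A}
  {Q0 : Measure B} {K : Kernel (B × A) ℝ}

theorem measurable_deltaS_of_unbiased [IsMarkovKernel K]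
    (hKmean : ∀ b' a', ∫ d, d ∂(K (b', a')) = deltaS P Ps b' a') :
    Measurable (Function.uncurry (deltaS P Ps)) := by
  have h := (StronglyMeasurable.integral_kernel_prod_right' (κ := K)
    (f := fun p : (B × A) × ℝ => p.2) measurable_snd.stronglyMeasurable).measurable
  convert h using 1
  ext ⟨b', a'⟩
  exact (hKmean b' a').symm

theorem deltaS_mem_Icc_of_unbiased [IsMarkovKernel K]
    (hKrange : ∀ b' a', ∀ᵐ d ∂(K (b', a')), d ∈ Set.Icc (0 : ℝ) 2)
    (hKmean : ∀ b' a', ∫ d, d ∂(K (b', a')) = deltaS P Ps b' a') (b' : B) (a' : A) :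
    deltaS P Ps b' a' ∈ Set.Icc (0 : ℝ) 2 := by
  rw [← hKmean]
  refine ⟨integral_nonneg_of_ae ((hKrange b' a').mono fun d hd => hd.1), ?_⟩
  refine (integral_mono_ae (Integrable.of_mem_Icc 0 2 aemeasurable_id (hKrange b' a'))
    (integrable_const 2) ((hKrange b' a').mono fun d hd => hd.2)).trans (by simp)

instance [IsMarkovKernel Ps] (i : ℕ) : IsProbabilityMeasure (beliefMarginal Ps π k b a i) :=
  Measure.isProbabilityMeasure_map (measurable_pi_apply _).aemeasurable

theorem importanceWeight_le_weightBound {i : ℕ} (hi : i ∈ Finset.Ioo k T) :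
    ∀ᵐ b' ∂Q0, importanceWeight Ps π k b a Q0 i b' ≤ weightBound Ps π k T b a Q0 :=
  (ENNReal.ae_le_essSup _).mono fun _ hb' => hb'.trans
    (Finset.le_sup (f := fun i => essSup (importanceWeight Ps π k b a Q0 i) Q0) hi)

theorem one_le_weightBound [IsMarkovKernel Ps] [IsProbabilityMeasure Q0] {i : ℕ}
    (hi : i ∈ Finset.Ioo k T) (hac : beliefMarginal Ps π k b a i ≪ Q0) :
    1 ≤ weightBound Ps π k T b a Q0 := by
  calc (1 : ℝ≥0∞) = ∫⁻ b', importanceWeight Ps π k b a Q0 i b' ∂Q0 := by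
        rw [importanceWeight, Measure.lintegral_rnDeriv hac, measure_univ]
    _ ≤ ∫⁻ _, weightBound Ps π k T b a Q0 ∂Q0 :=
        lintegral_mono_ae (importanceWeight_le_weightBound hi)
    _ = weightBound Ps π k T b a Q0 := by simp

/-- The contribution of one sample to the estimator `gHatTerm`. -/
noncomputable def sampleTerm (w : B → ℝ≥0∞) (level : ℝ) (s : B × ℝ × ℝ) : ℝ :=
  (w s.1).toReal * s.2.2 * (if s.2.1 ≤ level then 1 else 0)

theorem measurable_sampleTerm {w : B → ℝ≥0∞} (hw : Measurable w) (level : ℝ) :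
    Measurable (sampleTerm w level) := by
  unfold sampleTerm
  refine Measurable.mul (by fun_prop) (Measurable.ite ?_ measurable_const measurable_const)
  exact measurableSet_le (by fun_prop) measurable_const

theorem measurable_importanceWeight (i : ℕ) : Measurable (importanceWeight Ps π k b a Q0 i) :=
  Measure.measurable_rnDeriv _ _

variable [IsMarkovKernel Ps] [IsMarkovKernel K]

instance (i : ℕ) : IsMarkovKernel (returnGivenBelief Ps c π k b a i) := by
  unfold returnGivenBelief
  infer_instance

theorem sampleTerm_mem_Icc {i : ℕ} (hi : i ∈ Finset.Ioo k T)
    (hB : weightBound Ps π k T b a Q0 ≠ ⊤)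
    (hKrange : ∀ b' a', ∀ᵐ d ∂(K (b', a')), d ∈ Set.Icc (0 : ℝ) 2) (level : ℝ) :
    ∀ᵐ s ∂(sampleLaw Ps c π k b a Q0 K i),
      sampleTerm (importanceWeight Ps π k b a Q0 i) level s ∈
        Set.Icc 0 (2 * (weightBound Ps π k T b a Q0).toReal) := by
  have hmeas := measurable_sampleTerm (measurable_importanceWeight (Ps := Ps) (π := π) (k := k)
    (b := b) (a := a) (Q0 := Q0) i) level
  refine Measure.ae_compProd_of_ae_ae (hmeas measurableSet_Icc) ?_
  filter_upwards [importanceWeight_le_weightBound (Ps := Ps) (π := π) (b := b) (a := a)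
    (Q0 := Q0) hi] with b' hb'
  have hw := ENNReal.toReal_mono hB hb'
  have hK : ∀ᵐ d ∂(K.comap (fun b' => (b', π.act i b'))
      (measurable_id.prodMk (π.measurable_act i)) b'), d ∈ Set.Icc (0 : ℝ) 2 := hKrange _ _
  rw [Kernel.prod_apply]
  have := Measure.quasiMeasurePreserving_snd (μ := returnGivenBelief Ps c π k b a i b') |>.ae hK
  filter_upwards [this] with s hs
  have h0 : 0 ≤ (importanceWeight Ps π k b a Q0 i b').toReal := ENNReal.toReal_nonneg
  unfold sampleTerm
  split_ifs
  · rw [mul_one]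
    exact ⟨mul_nonneg h0 hs.1, by nlinarith [hs.1, hs.2]⟩
  · rw [mul_zero]
    exact ⟨le_rfl, by linarith⟩

variable [IsProbabilityMeasure Q0]

instance (i : ℕ) : IsProbabilityMeasure (sampleLaw Ps c π k b a Q0 K i) := by
  unfold sampleLaw
  infer_instance

/-- The importance sampling estimator is unbiased: the weight turns the proposal into the law of
the belief in the simplified model, and the conditional law of the return given the belief
reassembles the joint law of the two. -/
theorem integral_sampleTerm {i : ℕ} (hi : i ∈ Finset.Ioo k T)
    (hac : beliefMarginal Ps π k b a i ≪ Q0)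
    (hB : weightBound Ps π k T b a Q0 ≠ ⊤) (hc : Measurable (Function.uncurry c))
    (hKrange : ∀ b' a', ∀ᵐ d ∂(K (b', a')), d ∈ Set.Icc (0 : ℝ) 2)
    (hKmean : ∀ b' a', ∫ d, d ∂(K (b', a')) = deltaS P Ps b' a') (level : ℝ) :
    ∫ s, sampleTerm (importanceWeight Ps π k b a Q0 i) level s
        ∂(sampleLaw Ps c π k b a Q0 K i) =
      expectedDelta P Ps c π k b a (i - k) level := by
  have hd := measurable_deltaS_of_unbiased hKmean
  have hd02 := deltaS_mem_Icc_of_unbiased hKrange hKmean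
  have hki : k < i := (Finset.mem_Ioo.1 hi).1
  have hact : ∀ b', actionAt π k a (i - k) b' = π.act i b' := fun b' => by
    rw [actionAt, if_neg (by omega), Nat.add_sub_cancel' hki.le]
  have hint : Integrable (sampleTerm (importanceWeight Ps π k b a Q0 i) level)
      (sampleLaw Ps c π k b a Q0 K i) :=
    Integrable.of_mem_Icc _ _
      (measurable_sampleTerm (measurable_importanceWeight i) level).aemeasurable
      (sampleTerm_mem_Icc hi hB hKrange level)
  have hinner : ∀ b', ∫ s, sampleTerm (importanceWeight Ps π k b a Q0 i) level (b', s)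
      ∂((returnGivenBelief Ps c π k b a i ×ₖ K.comap (fun b' => (b', π.act i b'))
        (measurable_id.prodMk (π.measurable_act i))) b') =
      ((beliefMarginal Ps π k b a i).rnDeriv Q0 b').toReal •
        ∫ r, deltaS P Ps b' (π.act i b') * (Set.Iic level).indicator (1 : ℝ → ℝ) r
          ∂(returnGivenBelief Ps c π k b a i b') := by
    intro b'
    rw [Kernel.prod_apply, Kernel.comap_apply]
    have hf : ∀ s : ℝ × ℝ, sampleTerm (importanceWeight Ps π k b a Q0 i) level (b', s) =
        ((importanceWeight Ps π k b a Q0 i b').toReal *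
          (Set.Iic level).indicator (1 : ℝ → ℝ) s.1) * s.2 := fun s => by
      by_cases h : s.1 ≤ level
      · simp [sampleTerm, h]
      · simp [sampleTerm, h]
    simp_rw [hf]
    rw [integral_prod_mul (fun r => (importanceWeight Ps π k b a Q0 i b').toReal *
      (Set.Iic level).indicator (1 : ℝ → ℝ) r) (fun d : ℝ => d), hKmean, integral_const_mul,
      integral_const_mul, smul_eq_mul, importanceWeight]
    ring
  rw [sampleLaw] at hint ⊢
  rw [Measure.integral_compProd hint]
  simp_rw [hinner]
  rw [integral_rnDeriv_smul hac]
  have hlast : Measurable fun τ : Fin (i - k + 1) → B => τ (Fin.last (i - k)) :=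
    measurable_pi_apply _
  have hfm := measurable_futureReturn (π := π) (k := k) hc (i - k)
  have hG : Measurable fun p : B × ℝ =>
      deltaS P Ps p.1 (π.act i p.1) * (Set.Iic level).indicator (1 : ℝ → ℝ) p.2 :=
    (hd.comp (measurable_fst.prodMk ((π.measurable_act i).comp measurable_fst))).mul
      ((measurable_one.indicator measurableSet_Iic).comp measurable_snd)
  have hG02 : ∀ p : B × ℝ, deltaS P Ps p.1 (π.act i p.1) *
      (Set.Iic level).indicator (1 : ℝ → ℝ) p.2 ∈ Set.Icc (0 : ℝ) 2 := fun p => by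
    have h := hd02 p.1 (π.act i p.1)
    by_cases h' : p.2 ∈ Set.Iic level
    · simpa [h'] using h
    · simp [h']
  have hcond : (beliefMarginal Ps π k b a i) ⊗ₘ (returnGivenBelief Ps c π k b a i) =
      (pathLaw Ps π k b a (i - k)).map
        fun τ => (τ (Fin.last (i - k)), futureReturn c π k (i - k) τ) :=
    compProd_map_condDistrib hfm.aemeasurable
  rw [← Measure.integral_compProd (f := fun p : B × ℝ =>
      deltaS P Ps p.1 (π.act i p.1) * (Set.Iic level).indicator (1 : ℝ → ℝ) p.2)
      (Integrable.of_mem_Icc 0 2 hG.aemeasurable (.of_forall hG02)), hcond,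
    integral_map (hlast.prodMk hfm).aemeasurable hG.aestronglyMeasurable, expectedDelta]
  simp_rw [hact]

/-- Concentration of the estimator at a single time and level. -/
theorem measure_le_expectedDelta_sub_gHatTerm {Ω : Type*} [MeasurableSpace Ω] {μ : Measure Ω}
    [IsProbabilityMeasure μ] {N : ℕ} (hN : 0 < N) {i : ℕ} (hi : i ∈ Finset.Ioo k T)
    (hac : beliefMarginal Ps π k b a i ≪ Q0)
    (hB : weightBound Ps π k T b a Q0 ≠ ⊤) (hc : Measurable (Function.uncurry c))
    (hKrange : ∀ b' a', ∀ᵐ d ∂(K (b', a')), d ∈ Set.Icc (0 : ℝ) 2)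
    (hKmean : ∀ b' a', ∫ d, d ∂(K (b', a')) = deltaS P Ps b' a')
    {D : Fin N → Ω → B × ℝ × ℝ} (hDlaw : ∀ n, HasLaw (D n) (sampleLaw Ps c π k b a Q0 K i) μ)
    (hDindep : iIndepFun D μ) (level : ℝ) {t : ℝ} (ht : 0 ≤ t) :
    μ {ω | t ≤ expectedDelta P Ps c π k b a (i - k) level -
        gHatTerm (importanceWeight Ps π k b a Q0 i) (fun n => D n ω) level} ≤
      ENNReal.ofReal (Real.exp
        (-(N * t ^ 2 / (2 * (weightBound Ps π k T b a Q0).toReal ^ 2)))) := by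
  have hmeas := measurable_sampleTerm (measurable_importanceWeight (Ps := Ps) (π := π) (k := k)
    (b := b) (a := a) (Q0 := Q0) i) level
  have h := measure_le_sub_sampleMean_le_exp (μ := μ)
    (X := fun n ω => sampleTerm (importanceWeight Ps π k b a Q0 i) level (D n ω))
    (hDindep.comp (fun _ => sampleTerm (importanceWeight Ps π k b a Q0 i) level) fun _ => hmeas)
    (fun n => hmeas.comp_aemeasurable (hDlaw n).aemeasurable)
    (fun n => ((hDlaw n).ae_iff (measurableSet_setOfPred.1 (hmeas measurableSet_Icc))).2
      (sampleTerm_mem_Icc hi hB hKrange level))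
    (fun n => ((hDlaw n).integral_comp hmeas.aestronglyMeasurable).trans
      (integral_sampleTerm hi hac hB hc hKrange hKmean level)) hN ht
  have hexp : 2 * N * t ^ 2 / (2 * (weightBound Ps π k T b a Q0).toReal - 0) ^ 2 =
      N * t ^ 2 / (2 * (weightBound Ps π k T b a Q0).toReal ^ 2) := by
    rw [sub_zero, mul_pow, mul_assoc, sq 2, mul_assoc 2 2, mul_div_mul_left _ _ two_ne_zero]
  rwa [hexp] at h

end Estimator

/-! ### Binning and domination of the distribution function -/

section Binning

variable {I : ℕ} {e : Fin (I + 1) → ℝ} {l : ℝ}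

theorem exists_bin (hl : l ∈ Set.Ioc (e 0) (e (Fin.last I))) :
    ∃ i : Fin I, e i.castSucc < l ∧ l ≤ e i.succ := by
  by_contra! h
  exact absurd hl.2 (not_le.2 (Fin.induction (motive := fun j => e j < l) hl.1
    (fun i hi => h i hi) (Fin.last I)))

theorem binUpper_of_mem_bin (he : Monotone e) (g : ℝ → ℝ) {i : Fin I} (hi : e i.castSucc < l)
    (hi' : l ≤ e i.succ) : binUpper e g l = g (e i.succ) := by
  rw [binUpper, Finset.sum_eq_single i]
  · rw [if_pos ⟨hi, hi'⟩, mul_one]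
  · intro j _ hj
    rw [if_neg, mul_zero]
    rintro ⟨h1, h2⟩
    rcases lt_or_gt_of_ne hj with h | h
    · exact absurd (h2.trans (he (Fin.succ_le_castSucc_iff.2 h))) (not_le.2 hi)
    · exact absurd (hi'.trans (he (Fin.succ_le_castSucc_iff.2 h))) (not_le.2 h1)
  · simp

theorem binUpper_of_notMem (he : Monotone e) (g : ℝ → ℝ)
    (hl : l ∉ Set.Ioc (e 0) (e (Fin.last I))) : binUpper e g l = 0 := by
  refine Finset.sum_eq_zero fun i _ => ?_
  rw [if_neg, mul_zero]
  exact fun h => hl ⟨(he (Fin.zero_le _)).trans_lt h.1, h.2.trans (he (Fin.le_last _))⟩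

/-- If two distribution functions carried by `(e 0, e I]` differ by at most a monotone `g`, and `h`
overestimates `g` up to `η` at the bin edges, then binning `h` corrects the smaller of them. -/
theorem le_min_one_add_binUpper_add (he : Monotone e) {F Fs g h : ℝ → ℝ} {η : ℝ} (hη : 0 ≤ η)
    (hF1 : ∀ l, F l ≤ 1) (hFs0 : ∀ l, 0 ≤ Fs l) (hF0 : ∀ l ≤ e 0, F l = 0)
    (hFs1 : ∀ l, e (Fin.last I) ≤ l → Fs l = 1) (hg : Monotone g)
    (hFg : ∀ l, F l ≤ Fs l + g l) (hgh : ∀ i : Fin I, g (e i.succ) ≤ h (e i.succ) + η) (l : ℝ) :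
    F l ≤ min 1 (Fs l + binUpper e h l + η) := by
  refine le_min (hF1 l) ?_
  by_cases hl : l ∈ Set.Ioc (e 0) (e (Fin.last I))
  · obtain ⟨i, hi, hi'⟩ := exists_bin hl
    rw [binUpper_of_mem_bin he h hi hi']
    linarith [hFg l, hg hi', hgh i]
  · rw [binUpper_of_notMem he h hl, add_zero]
    rw [Set.mem_Ioc, not_and_or, not_lt, not_le] at hl
    rcases hl with hl | hl
    · linarith [hF0 l hl, hFs0 l]
    · linarith [hFs1 l hl.le, hF1 l]

end Binning

/-! ### The lower bound for belief MDPs -/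

section LowerBound

variable {B A Ω : Type*} [MeasurableSpace B] [MeasurableSpace A] [MeasurableSpace Ω]
  {μ : Measure Ω} [IsProbabilityMeasure μ]
  {P Ps : Kernel (B × A) B} {c : B → A → ℝ} {Rmax : ℝ} {π : Policy B A} {k T : ℕ} {b : B} {a : A}
  {Q0 : Measure B} {K : Kernel (B × A) ℝ} {I N : ℕ} {e : Fin (I + 1) → ℝ} {η δ α : ℝ}

/-- The sample size `n` at which Hoeffding's bound for the deviation `t` of a mean of variables with
values in `[0, 2W]` falls below `q`. -/
theorem exp_neg_le_of_sampleSize {q W t n : ℝ} (hq : 0 < q) (hW : 0 < W) (ht : 0 < t)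
    (hn : -Real.log q * (2 * W ^ 2 / t ^ 2) ≤ n) :
    Real.exp (-(n * t ^ 2 / (2 * W ^ 2))) ≤ q := by
  rw [← Real.le_log_iff_exp_le hq, neg_le, le_div_iff₀ (by positivity)]
  have h := mul_le_mul_of_nonneg_right hn (sq_nonneg t)
  have h' : -Real.log q * (2 * W ^ 2 / t ^ 2) * t ^ 2 = -Real.log q * (2 * W ^ 2) := by
    field_simp
  rwa [h'] at h

/-- Union bound over the bin edges and the times. -/
theorem measure_exists_gHatTerm_add_le_expectedDelta [IsMarkovKernel Ps] [IsProbabilityMeasure Q0]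
    [IsMarkovKernel K] (hN : 0 < N) (hac : ∀ i ∈ Finset.Ioo k T, beliefMarginal Ps π k b a i ≪ Q0)
    (hB : weightBound Ps π k T b a Q0 ≠ ⊤) (hc : Measurable (Function.uncurry c))
    (hKrange : ∀ b' a', ∀ᵐ d ∂(K (b', a')), d ∈ Set.Icc (0 : ℝ) 2)
    (hKmean : ∀ b' a', ∫ d, d ∂(K (b', a')) = deltaS P Ps b' a')
    {D : ℕ → Fin N → Ω → B × ℝ × ℝ}
    (hDlaw : ∀ i ∈ Finset.Ioo k T, ∀ n, HasLaw (D i n) (sampleLaw Ps c π k b a Q0 K i) μ)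
    (hDindep : ∀ i ∈ Finset.Ioo k T, iIndepFun (D i) μ) (level : ℕ → Fin I → ℝ) {t q : ℝ}
    (ht : 0 ≤ t) (hq : Real.exp
      (-(N * t ^ 2 / (2 * (weightBound Ps π k T b a Q0).toReal ^ 2))) ≤ q) :
    μ {ω | ∃ j : Fin I, ∃ i ∈ Finset.Ioo k T, t ≤
        expectedDelta P Ps c π k b a (i - k) (level i j) -
          gHatTerm (importanceWeight Ps π k b a Q0 i) (fun n => D i n ω) (level i j)} ≤
      ENNReal.ofReal (I * ((Finset.Ioo k T).card * q)) := by
  have hset : {ω | ∃ j : Fin I, ∃ i ∈ Finset.Ioo k T, t ≤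
        expectedDelta P Ps c π k b a (i - k) (level i j) -
          gHatTerm (importanceWeight Ps π k b a Q0 i) (fun n => D i n ω) (level i j)} =
      ⋃ j ∈ (Finset.univ : Finset (Fin I)), ⋃ i ∈ Finset.Ioo k T, {ω | t ≤
        expectedDelta P Ps c π k b a (i - k) (level i j) -
          gHatTerm (importanceWeight Ps π k b a Q0 i) (fun n => D i n ω) (level i j)} := by
    ext ω
    simp only [Set.mem_ofPred_eq, Set.mem_iUnion, Finset.mem_univ, exists_prop, true_and]
  have hq0 : 0 ≤ q := (Real.exp_pos _).le.trans hq
  rw [hset]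
  refine (measure_biUnion_finset_le _ _).trans ?_
  refine (Finset.sum_le_sum fun j _ => (measure_biUnion_finset_le _ _).trans
    (Finset.sum_le_sum fun i hi => (measure_le_expectedDelta_sub_gHatTerm hN hi (hac i hi) hB hc
      hKrange hKmean (hDlaw i hi) (hDindep i hi) (level i j) ht).trans
        (ENNReal.ofReal_le_ofReal hq))).trans (le_of_eq ?_)
  rw [Finset.sum_const, Finset.sum_const, Finset.card_univ, Fintype.card_fin, nsmul_eq_mul,
    nsmul_eq_mul, ENNReal.ofReal_mul (by positivity), ENNReal.ofReal_mul (by positivity),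
    ENNReal.ofReal_natCast, ENNReal.ofReal_natCast]

/-- If the estimators of the expected distances are accurate at all bin edges, the corrected
distribution function dominates the one of the return under `P`. -/
theorem measureReal_totalReturn_le_cdfHat [IsMarkovKernel P] [IsMarkovKernel Ps]
    (hc : Measurable (Function.uncurry c)) (hcR : ∀ b a, |c b a| ≤ Rmax)
    (hd : Measurable (Function.uncurry (deltaS P Ps)))
    (hd02 : ∀ b a, deltaS P Ps b a ∈ Set.Icc (0 : ℝ) 2) (hkT : k < T) (he : Monotone e)
    (hcover : ∀ᵐ τ ∂(pathLaw P π k b a (T - k)),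
      totalReturn c π k b a (T - k) τ ∈ Set.Ioc (e 0) (e (Fin.last I)))
    (hcover_s : ∀ᵐ τ ∂(pathLaw Ps π k b a (T - k)),
      totalReturn c π k b a (T - k) τ ∈ Set.Ioc (e 0) (e (Fin.last I)))
    (hη : 0 ≤ η) {t : ℝ} (ht : (Finset.Ioo k T).card * t ≤ η) {s : ℕ → Fin N → B × ℝ × ℝ}
    (hs : ∀ j : Fin I, ∀ i ∈ Finset.Ioo k T,
      expectedDelta P Ps c π k b a (i - k) (shiftedLevel (c b a) Rmax T i (e j.succ)) -
        gHatTerm (importanceWeight Ps π k b a Q0 i) (s i)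
          (shiftedLevel (c b a) Rmax T i (e j.succ)) ≤ t) (l : ℝ) :
    (pathLaw P π k b a (T - k)).real {τ | totalReturn c π k b a (T - k) τ ≤ l} ≤
      cdfHat P Ps c Rmax π k T b a Q0 e η s l := by
  have hlevel : ∀ i, Monotone (shiftedLevel (c b a) Rmax T i) := fun i x y hxy => by
    unfold shiftedLevel
    linarith
  refine le_min_one_add_binUpper_add (F := fun l => (pathLaw P π k b a (T - k)).real
      {τ | totalReturn c π k b a (T - k) τ ≤ l}) he hη (fun _ => measureReal_le_one)
    (fun _ => measureReal_nonneg) ?_ ?_ ?_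
    (measureReal_totalReturn_le_add_sum hc hcR hd hd02 hkT) ?_ l
  · intro l hl
    rw [measureReal_def, measure_eq_zero_iff_ae_notMem.2, ENNReal.toReal_zero]
    filter_upwards [hcover] with τ hτ h
    exact absurd (hτ.1.trans_le (h.trans hl)) (lt_irrefl _)
  · intro l hl
    have hS : MeasurableSet {τ | totalReturn c π k b a (T - k) τ ≤ l} :=
      measurable_totalReturn hc _ measurableSet_Iic
    rw [measureReal_def, (prob_compl_eq_zero_iff hS).1, ENNReal.toReal_one]
    exact ae_iff.1 (hcover_s.mono fun τ hτ => hτ.2.trans hl)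
  · refine Monotone.add ?_ ?_
    · intro x y hxy
      have := hlevel k hxy
      simp only
      split_ifs with h1 h2
      · exact le_rfl
      · exact absurd (h1.trans this) h2
      · exact (hd02 _ _).1
      · exact le_rfl
    · intro x y hxy
      exact Finset.sum_le_sum fun i _ => expectedDelta_mono hc hd hd02 _ (hlevel i hxy)
  · intro j
    have h := Finset.sum_le_sum (hs j)
    rw [Finset.sum_sub_distrib, Finset.sum_const, nsmul_eq_mul] at h
    unfold gHat
    linarith

theorem totalReturn_mem_Icc (hcR : ∀ b a, |c b a| ≤ Rmax) (hkT : k ≤ T)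
    (τ : Fin (T - k + 1) → B) :
    totalReturn c π k b a (T - k) τ ∈
      Set.Icc (-(Rmax * ((T : ℝ) - k + 1))) (Rmax * ((T : ℝ) - k + 1)) := by
  have h1 := abs_le.1 (abs_futureReturn_le (π := π) (k := k) hcR (T - k) τ)
  have h2 := abs_le.1 (hcR b a)
  rw [Nat.cast_sub hkT] at h1
  unfold totalReturn
  constructor <;> nlinarith [h1.1, h1.2, h2.1, h2.2]

/-- Concentration of the sample CVaR of draws from the true return distribution by inverse
transform, combined with the domination of the quantiles by those of the true distribution. -/
theorem measure_qLowerHat_sub_qValue_le [IsMarkovKernel P] [IsMarkovKernel Ps]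
    [IsProbabilityMeasure Q0] [IsMarkovKernel K]
    (hc : Measurable (Function.uncurry c)) (hcR : ∀ b a, |c b a| ≤ Rmax) (hkT : k + 1 < T)
    (hac : ∀ i ∈ Finset.Ioo k T, beliefMarginal Ps π k b a i ≪ Q0)
    (hB : weightBound Ps π k T b a Q0 ≠ ⊤)
    (hKrange : ∀ b' a', ∀ᵐ d ∂(K (b', a')), d ∈ Set.Icc (0 : ℝ) 2)
    (hKmean : ∀ b' a', ∫ d, d ∂(K (b', a')) = deltaS P Ps b' a') (he : Monotone e)
    (hcover : ∀ᵐ τ ∂(pathLaw P π k b a (T - k)),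
      totalReturn c π k b a (T - k) τ ∈ Set.Ioc (e 0) (e (Fin.last I)))
    (hcover_s : ∀ᵐ τ ∂(pathLaw Ps π k b a (T - k)),
      totalReturn c π k b a (T - k) τ ∈ Set.Ioc (e 0) (e (Fin.last I)))
    (hη : 0 < η) (hδ : δ ∈ Set.Ioo (0 : ℝ) 1) (hα : α ∈ Set.Ioo (0 : ℝ) 1)
    (hN : -Real.log (((δ / 4) / I) / ((T : ℝ) - 1 - k) / 2) *
        (2 * (weightBound Ps π k T b a Q0).toReal ^ 2 / (η ^ 2 / ((T : ℝ) - 1 - k) ^ 2)) ≤ N)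
    {D : ℕ → Fin N → Ω → B × ℝ × ℝ}
    (hDlaw : ∀ i ∈ Finset.Ioo k T, ∀ n, HasLaw (D i n) (sampleLaw Ps c π k b a Q0 K i) μ)
    (hDindep : ∀ i ∈ Finset.Ioo k T, iIndepFun (D i) μ) {U : Fin N → Ω → ℝ}
    (hUlaw : ∀ j, HasLaw (U j) (volume.restrict (Set.Icc (0 : ℝ) 1)) μ)
    (hUindep : iIndepFun U μ) :
    μ {ω | qLowerHat P Ps c Rmax π k T b a Q0 e η α (fun i n => D i n ω) (fun j => U j ω)
        - qValue P c π k T b a α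
        > 2 * Rmax * ((T : ℝ) - k + 1) / α * Real.sqrt (Real.log (1 / (δ / 4)) / (2 * N))}
      ≤ ENNReal.ofReal δ := by
  have hδ0 := hδ.1
  have hδ1 := hδ.2
  have hT : (1 : ℝ) ≤ (T : ℝ) - 1 - k := by
    have : ((k + 2 : ℕ) : ℝ) ≤ T := by exact_mod_cast hkT
    push_cast at this
    linarith
  have hcard : ((Finset.Ioo k T).card : ℝ) = (T : ℝ) - 1 - k := by
    rw [Nat.card_Ioo, Nat.sub_sub, Nat.cast_sub hkT.le]
    push_cast
    ring
  -- A return lies in some bin, so there is at least one.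
  have hI : (1 : ℝ) ≤ I := by
    obtain ⟨τ, hτ⟩ := hcover.exists
    obtain ⟨i, -⟩ := exists_bin hτ
    exact_mod_cast i.pos
  -- The sample size condition gives `N > 0`, because `q < 1` and `W > 0`. The weight bound is
  -- positive because the importance weight is the density of a probability measure.
  have hk1 : k + 1 ∈ Finset.Ioo k T := Finset.mem_Ioo.2 ⟨k.lt_succ_self, hkT⟩
  have hW : (0 : ℝ) < (weightBound Ps π k T b a Q0).toReal :=
    ENNReal.toReal_pos (one_pos.trans_le (one_le_weightBound hk1 (hac _ hk1))).ne' hB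
  set W := (weightBound Ps π k T b a Q0).toReal with hWdef
  set q : ℝ := ((δ / 4) / I) / ((T : ℝ) - 1 - k) / 2 with hq
  have hq0 : 0 < q := by positivity
  have hq1 : q < 1 := by
    have h1 : δ / 4 / I ≤ δ / 4 := div_le_self (by positivity) hI
    have h2 : δ / 4 / I / ((T : ℝ) - 1 - k) ≤ δ / 4 / I := div_le_self (by positivity) hT
    rw [hq]
    linarith
  set t : ℝ := η / ((T : ℝ) - 1 - k) with ht
  have ht0 : 0 < t := by positivity
  rw [← div_pow, ← ht] at hN
  have hNpos : 0 < N := by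
    have : 0 < -Real.log q := neg_pos.2 (Real.log_neg hq0 hq1)
    exact Nat.cast_pos.1 (lt_of_lt_of_le (by positivity) hN)
  have hexp := exp_neg_le_of_sampleSize hq0 hW ht0 hN
  have hd := measurable_deltaS_of_unbiased hKmean
  have hd02 := deltaS_mem_Icc_of_unbiased hKrange hKmean
  set m : ℝ := Rmax * ((T : ℝ) - k + 1) with hm
  have hRmeas : Measurable (totalReturn c π k b a (T - k)) := measurable_totalReturn hc _
  set ν : Measure ℝ := (pathLaw P π k b a (T - k)).map (totalReturn c π k b a (T - k)) with hνdef
  have hνprob : IsProbabilityMeasure ν := Measure.isProbabilityMeasure_map hRmeas.aemeasurable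
  have hν : ∀ᵐ x ∂ν, x ∈ Set.Icc (-m) m :=
    (ae_map_iff (p := fun x => x ∈ Set.Icc (-m) m) hRmeas.aemeasurable measurableSet_Icc).2
      (.of_forall fun τ => totalReturn_mem_Icc hcR (by omega) τ)
  have hcdf : ∀ l, cdf ν l =
      (pathLaw P π k b a (T - k)).real {τ | totalReturn c π k b a (T - k) τ ≤ l} := fun l => by
    rw [cdf_eq_real, hνdef, map_measureReal_apply hRmeas measurableSet_Iic]
    rfl
  have hqV : qValue P c π k T b a α = cvar ν id α := by
    unfold qValue cvar
    congr 1
    ext w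
    rw [hνdef, integral_map hRmeas.aemeasurable (by fun_prop)]
    rfl
  have hqmeas := (monotone_quantileFrom_cdf_min_one hν).measurable
  -- Draws from the true return distribution, by the same uniform variables.
  set Y : Fin N → Ω → ℝ := fun j ω => quantileFrom (-m) (cdf ν) (min (U j ω) 1) with hY
  have hYlaw : ∀ j, HasLaw (Y j) ν μ := fun j => (hasLaw_quantileFrom_cdf hν).fun_comp (hUlaw j)
  have hYindep : iIndepFun Y μ :=
    hUindep.comp (fun _ u => quantileFrom (-m) (cdf ν) (min u 1)) fun _ => hqmeas
  have hU1 : ∀ᵐ ω ∂μ, ∀ j, U j ω ≤ 1 := ae_all_iff.2 fun j =>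
    ((hUlaw j).ae_iff (measurableSet_setOfPred.1 measurableSet_Iic)).2
      ((ae_restrict_mem measurableSet_Icc).mono fun u hu => hu.2)
  set bad : Set Ω := {ω | ∃ j : Fin I, ∃ i ∈ Finset.Ioo k T, t ≤
    expectedDelta P Ps c π k b a (i - k) (shiftedLevel (c b a) Rmax T i (e j.succ)) -
      gHatTerm (importanceWeight Ps π k b a Q0 i) (fun n => D i n ω)
        (shiftedLevel (c b a) Rmax T i (e j.succ))} with hbad
  set dev : Set Ω := {ω | 2 * m / α * Real.sqrt (Real.log (1 / (δ / 4)) / (2 * N)) <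
    cvarHat α (fun j => Y j ω) - cvar ν id α} with hdev
  have hbadle : μ bad ≤ ENNReal.ofReal (δ / 8) := by
    refine (measure_exists_gHatTerm_add_le_expectedDelta hNpos hac hB hc hKrange hKmean hDlaw
      hDindep (fun i j => shiftedLevel (c b a) Rmax T i (e j.succ)) ht0.le hexp).trans
      (le_of_eq ?_)
    congr 1
    rw [hcard, hq]
    field_simp
    norm_num
  have hdevle : μ dev ≤ ENNReal.ofReal (δ / 4) :=
    measure_lt_cvarHat_sub_cvar_le hNpos hYindep hYlaw hν hα (by positivity) (by linarith)
  calc μ {ω | qLowerHat P Ps c Rmax π k T b a Q0 e η α (fun i n => D i n ω) (fun j => U j ω)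
        - qValue P c π k T b a α
        > 2 * Rmax * ((T : ℝ) - k + 1) / α * Real.sqrt (Real.log (1 / (δ / 4)) / (2 * N))}
      ≤ μ (bad ∪ dev) := by
        refine measure_mono_ae ?_
        filter_upwards [hU1] with ω hω h
        by_cases hωbad : ω ∈ bad
        · exact Or.inl hωbad
        · refine Or.inr ?_
          have hgood : ∀ j : Fin I, ∀ i ∈ Finset.Ioo k T, _ ≤ t := fun j i hi =>
            le_of_not_ge fun hle => hωbad ⟨j, i, hi, hle⟩
          have hdom : ∀ l, cdf ν l ≤
              cdfHat P Ps c Rmax π k T b a Q0 e η (fun i n => D i n ω) l := fun l => by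
            rw [hcdf]
            refine measureReal_totalReturn_le_cdfHat hc hcR hd hd02 (by omega) he hcover hcover_s
              hη.le (t := t) (le_of_eq ?_) hgood l
            rw [hcard, ht]
            field_simp
          have hle : qLowerHat P Ps c Rmax π k T b a Q0 e η α (fun i n => D i n ω)
              (fun j => U j ω) ≤ cvarHat α (fun j => Y j ω) := by
            refine cvarHat_mono hNpos hα fun j => ?_
            simp only [hY, min_eq_left (hω j)]
            exact quantileFrom_le_quantileFrom_cdf hν hdom (hω j)
          replace h : _ ∈ Set.ofPred _ := h
          rw [Set.mem_ofPred_eq, hqV] at h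
          rw [hdev, Set.mem_ofPred_eq, hm, ← mul_assoc]
          exact lt_of_lt_of_le h (sub_le_sub_right hle _)
    _ ≤ μ bad + μ dev := measure_union_le _ _
    _ ≤ ENNReal.ofReal (δ / 8) + ENNReal.ofReal (δ / 4) := add_le_add hbadle hdevle
    _ = ENNReal.ofReal (δ / 8 + δ / 4) := (ENNReal.ofReal_add (by positivity) (by positivity)).symm
    _ ≤ ENNReal.ofReal δ := ENNReal.ofReal_le_ofReal (by linarith)

end LowerBound

/-! ### Costs of particle beliefs -/

namespace POMDP

variable {X A Z : Type*} [MeasurableSpace X] [MeasurableSpace A] [MeasurableSpace Z]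
  (M : POMDP X A Z) {N : ℕ}

theorem measurable_particleCost :
    Measurable (Function.uncurry (M.particleCost : ParticleBelief N X → A → ℝ)) := by
  refine Measurable.div (Finset.measurable_sum _ fun j _ => Measurable.mul ?_ ?_)
    (Finset.measurable_sum _ fun j _ => ?_)
  · exact (measurable_snd.comp ((measurable_pi_apply j).comp measurable_fst)).coe_nnreal_real
  · exact M.measurable_cost.comp
      ((measurable_fst.comp ((measurable_pi_apply j).comp measurable_fst)).prodMk measurable_snd)
  · exact (measurable_snd.comp ((measurable_pi_apply j).comp measurable_fst)).coe_nnreal_real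

theorem abs_particleCost_le {Rmax : ℝ} (hR0 : 0 ≤ Rmax) (hR : ∀ x a, |M.cost x a| ≤ Rmax)
    (b : ParticleBelief N X) (a : A) : |M.particleCost b a| ≤ Rmax := by
  have hs : 0 ≤ ∑ j, ((b j).2 : ℝ) := Finset.sum_nonneg fun j _ => (b j).2.coe_nonneg
  rw [particleCost, abs_div, abs_of_nonneg hs]
  refine div_le_of_le_mul₀ hs hR0 ((Finset.abs_sum_le_sum_abs _ _).trans ?_)
  rw [Finset.mul_sum]
  refine Finset.sum_le_sum fun j _ => ?_
  rw [abs_mul, abs_of_nonneg (b j).2.coe_nonneg, mul_comm]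
  exact mul_le_mul_of_nonneg_right (hR _ _) (b j).2.coe_nonneg

end POMDP

end RiskPOMDP

theorem mainTheorem7
    {X A Z Ω : Type*} [MeasurableSpace X] [MeasurableSpace A] [MeasurableSpace Z]
    [MeasurableSpace Ω] (μ : Measure Ω) [IsProbabilityMeasure μ]
    (M : RiskPOMDP.POMDP X A Z) (Rmax : ℝ) (hR : ∀ x a, |M.cost x a| ≤ Rmax)
    (Nx : ℕ) [NeZero Nx]
    (Ps : Kernel (RiskPOMDP.ParticleBelief Nx X × A) (RiskPOMDP.ParticleBelief Nx X))
    [IsMarkovKernel Ps]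
    (π : RiskPOMDP.Policy (RiskPOMDP.ParticleBelief Nx X) A)
    (k T : ℕ) (hkT : k + 1 < T)
    (b : RiskPOMDP.ParticleBelief Nx X) (a : A)
    -- proposal distribution of the delta beliefs
    (Q0 : Measure (RiskPOMDP.ParticleBelief Nx X)) [IsProbabilityMeasure Q0]
    (hac : ∀ i ∈ Finset.Ioo k T, RiskPOMDP.beliefMarginal Ps π k b a i ≪ Q0)
    (hB : RiskPOMDP.weightBound Ps π k T b a Q0 ≠ ⊤)
    -- unbiased, `[0,2]`-valued estimator of the distance between the models
    (K : Kernel (RiskPOMDP.ParticleBelief Nx X × A) ℝ) [IsMarkovKernel K]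
    (hKrange : ∀ b' a', ∀ᵐ d ∂(K (b', a')), d ∈ Set.Icc (0 : ℝ) 2)
    (hKmean : ∀ b' a', ∫ d, d ∂(K (b', a')) = RiskPOMDP.deltaS M.particleKernel Ps b' a')
    -- bins covering the returns
    (I : ℕ) (e : Fin (I + 1) → ℝ) (he : Monotone e)
    (hcover : ∀ᵐ τ ∂(RiskPOMDP.pathLaw M.particleKernel π k b a (T - k)),
      RiskPOMDP.totalReturn M.particleCost π k b a (T - k) τ ∈ Set.Ioc (e 0) (e (Fin.last I)))
    (hcover_s : ∀ᵐ τ ∂(RiskPOMDP.pathLaw Ps π k b a (T - k)),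
      RiskPOMDP.totalReturn M.particleCost π k b a (T - k) τ ∈ Set.Ioc (e 0) (e (Fin.last I)))
    (η δ α : ℝ) (hη : 0 < η) (hδ : δ ∈ Set.Ioo (0 : ℝ) 1) (hα : α ∈ Set.Ioo (0 : ℝ) 1)
    -- sample size
    (N : ℕ)
    (hN : -Real.log (((δ / 4) / I) / ((T : ℝ) - 1 - k) / 2) *
        (2 * (RiskPOMDP.weightBound Ps π k T b a Q0).toReal ^ 2 /
          (η ^ 2 / ((T : ℝ) - 1 - k) ^ 2)) ≤ N)
    -- for each time, i.i.d. delta samples; any dependence between different times is allowed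
    (D : ℕ → Fin N → Ω → RiskPOMDP.ParticleBelief Nx X × ℝ × ℝ)
    (hDlaw : ∀ i ∈ Finset.Ioo k T, ∀ n,
      HasLaw (D i n) (RiskPOMDP.sampleLaw Ps M.particleCost π k b a Q0 K i) μ)
    (hDindep : ∀ i ∈ Finset.Ioo k T, iIndepFun (D i) μ)
    -- i.i.d. uniform variables, independent of the delta samples
    (U : Fin N → Ω → ℝ)
    (hUlaw : ∀ j, HasLaw (U j) (volume.restrict (Set.Icc (0 : ℝ) 1)) μ)
    (hUindep : iIndepFun U μ)
    (hUD : IndepFun (fun ω j => U j ω)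
      (fun ω (p : {i // i ∈ Finset.Ioo k T} × Fin N) => D p.1 p.2 ω) μ) :
    μ {ω | RiskPOMDP.qLowerHat M.particleKernel Ps M.particleCost Rmax π k T b a Q0 e η α
          (fun i n => D i n ω) (fun j => U j ω)
        - RiskPOMDP.qValue M.particleKernel M.particleCost π k T b a α
        > 2 * Rmax * ((T : ℝ) - k + 1) / α * Real.sqrt (Real.log (1 / (δ / 4)) / (2 * N))}
      ≤ ENNReal.ofReal δ := by
  have hR0 : 0 ≤ Rmax := (abs_nonneg _).trans (hR (b 0).1 a)
  exact RiskPOMDP.measure_qLowerHat_sub_qValue_le M.measurable_particleCost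
    (M.abs_particleCost_le hR0 hR) hkT hac hB hKrange hKmean he hcover hcover_s hη hδ hα hN hDlaw
    hDindep hUlaw hUindep
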